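/- Let $k$ be a field with $\operatorname{char} k\neq 2$, and let $C/k$ be the complete nonsingular curve with affine equation $$Y^2=f(X)=c\prod_{r\in R}(X-r),$$ where $f\in k[X]$ has degree at least $1$ and has no repeated roots in an algebraic closure $\bar k$ of $k$, and $R\subset\bar k$ is its set of roots (so genus $\le 1$ is allowed). Let $\iota$ be the hyperelliptic involution $(X,Y)\mapsto(X,-Y)$. Let $G\subset\operatorname{Aut}_k C$ be a finite group of affine automorphisms, that is, $$g(X)=\alpha(g)X+\beta(g),\qquad g(Y)=\gamma(g)Y\qquad(g\in G)$$ with $\alpha(g),\beta(g),\gamma(g)\in k$. Then $G$ acts on $R$ through the $X$-coordinate. Let $r$ be the number of regular orbits of $G$ on $R$, that is, of orbits on which no non-trivial element of $G$ has a fixed point. Let $C/G$ be the quotient curve, the complete nonsingular curve over $k$ with function field $k(C)^G$. Then $$ \operatorname{genus}(C/G)=\begin{cases} 0 & \text{if } \iota\in G,\\[2pt] \bigl\lfloor \frac r2-\frac12\bigr\rfloor=\bigl\lfloor \frac{|R|}{2|G|}-\frac12\bigr\rfloor & \text{if } \gamma \text{ is trivial},\\[4pt] \bigl\lfloor \frac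 r2\bigr\rfloor=\bigl\lfloor \frac{|R|}{2|G|}\bigr\rfloor & \text{if } \iota\notin G \text{ and } \gamma \text{ is non-trivial}. \end{cases} $$ -/

import Mathlib

open Polynomial

noncomputable section

/-- The data of a hyperelliptic curve `Y ^ 2 = f(X)` over `k`: a polynomial of degree at least `1`
without repeated roots in an algebraic closure of `k` (genus `≤ 1` is allowed). -/
structure HyperellipticCurve (k : Type*) [Field k] where
  /-- the right-hand side `f` of the equation -/
  f : k[X]
  natDegree_pos : 0 < f.natDegree
  separable : f.Separable

namespace HyperellipticCurve

variable {k : Type*} [Field k] (C : HyperellipticCurve k)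

/-- The polynomial `Y ^ 2 - f(X)` in `k[X][Y]`. -/
def equation : k[X][X] := X ^ 2 - Polynomial.C C.f

theorem equation_monic : C.equation.Monic :=
  monic_X_pow_sub_C C.f two_ne_zero

theorem equation_natDegree : C.equation.natDegree = 2 :=
  natDegree_X_pow_sub_C

theorem equation_irreducible : Irreducible C.equation := by
  have hdeg := C.equation_natDegree
  rw [C.equation_monic.irreducible_iff_roots_eq_zero_of_degree_le_three (by omega) (by omega)]
  refine Multiset.eq_zero_of_forall_notMem fun q hq => ?_
  have hroot : C.equation.eval q = 0 := (mem_roots'.mp hq).2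
  have hf : C.f = q * q := by
    simp only [equation, eval_sub, eval_pow, eval_X, eval_C] at hroot
    rw [← sq]
    exact (sub_eq_zero.mp hroot).symm
  have hunit : IsUnit q := C.separable.squarefree q (hf ▸ dvd_rfl)
  have hpos := C.natDegree_pos
  rw [hf, natDegree_mul hunit.ne_zero hunit.ne_zero, natDegree_eq_zero_of_isUnit hunit] at hpos
  exact lt_irrefl _ hpos

/-- The affine coordinate ring `k[X, Y] / (Y ^ 2 - f(X))`. -/
abbrev CoordinateRing : Type _ := AdjoinRoot C.equation

instance : IsDomain C.CoordinateRing :=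
  AdjoinRoot.isDomain_of_prime C.equation_irreducible.prime

/-- The function field `k(C)`, which determines the complete nonsingular curve `C`; automorphisms
of `C` over `k` are the automorphisms of the field `k(C)` over `k`. -/
abbrev FunctionField : Type _ := FractionRing C.CoordinateRing

/-- The coordinate function `X` on `C`. -/
def xCoord : C.FunctionField :=
  algebraMap C.CoordinateRing _ (AdjoinRoot.of C.equation X)

/-- The coordinate function `Y` on `C`. -/
def yCoord : C.FunctionField :=
  algebraMap C.CoordinateRing _ (AdjoinRoot.root C.equation)

theorem root_sq :
    AdjoinRoot.root C.equation ^ 2 = AdjoinRoot.of C.equation C.f := by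
  have h := AdjoinRoot.eval₂_root C.equation
  have h' : ∀ p : k[X][X], p = X ^ 2 - Polynomial.C C.f →
      p.eval₂ (AdjoinRoot.of C.equation) (AdjoinRoot.root C.equation) =
        AdjoinRoot.root C.equation ^ 2 - AdjoinRoot.of C.equation C.f := by
    rintro p rfl
    simp
  exact sub_eq_zero.mp ((h' _ rfl).symm.trans h)

/-- The endomorphism `X ↦ X`, `Y ↦ -Y` of the affine coordinate ring. -/
def negHom : C.CoordinateRing →ₐ[k[X]] C.CoordinateRing :=
  AdjoinRoot.liftAlgHom C.equation (Algebra.ofId k[X] C.CoordinateRing)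
    (-AdjoinRoot.root C.equation) (by
      have h' : ∀ p : k[X][X], p = X ^ 2 - Polynomial.C C.f →
          p.eval₂ (Algebra.ofId k[X] C.CoordinateRing : k[X] →+* C.CoordinateRing)
            (-AdjoinRoot.root C.equation) =
          AdjoinRoot.root C.equation ^ 2 - AdjoinRoot.of C.equation C.f := by
        rintro p rfl
        simp [AdjoinRoot.algebraMap_eq]
      exact (h' _ rfl).trans (by rw [C.root_sq, sub_self]))

theorem negHom_root : C.negHom (AdjoinRoot.root C.equation) = -AdjoinRoot.root C.equation :=
  AdjoinRoot.liftAlgHom_root _ _ _ _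

theorem negHom_comp : C.negHom.comp C.negHom = AlgHom.id k[X] C.CoordinateRing := by
  apply AdjoinRoot.algHom_ext
  simp [negHom_root]

/-- The hyperelliptic involution `ι : (X, Y) ↦ (X, -Y)`, as an automorphism of `k(C)`. -/
def involution : C.FunctionField ≃ₐ[k] C.FunctionField :=
  IsFractionRing.fieldEquivOfAlgEquiv k C.FunctionField C.FunctionField
    ((AlgEquiv.ofAlgHom C.negHom C.negHom C.negHom_comp C.negHom_comp).restrictScalars k)

theorem involution_xCoord : C.involution C.xCoord = C.xCoord := by
  rw [involution, xCoord, IsFractionRing.fieldEquivOfAlgEquiv_algebraMap]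
  exact congrArg _ (C.negHom.commutes X)

theorem involution_yCoord : C.involution C.yCoord = -C.yCoord := by
  rw [involution, yCoord, IsFractionRing.fieldEquivOfAlgEquiv_algebraMap, ← map_neg]
  exact congrArg _ C.negHom_root

/-- The set `R` of roots of `f` in the algebraic closure of `k`. -/
def roots : Set (AlgebraicClosure k) := C.f.rootSet (AlgebraicClosure k)

/-- The function field `k(C)^G` of the quotient curve `C/G`, which is the complete nonsingular
curve over `k` with this function field. -/
abbrev QuotientFunctionField (G : Subgroup (C.FunctionField ≃ₐ[k] C.FunctionField)) : Type _ :=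
  IntermediateField.fixedField G

end HyperellipticCurve

section AffineAction

variable {k : Type*} [Field k] {G : Type*}

/-- The action of `g` on the affine line over the algebraic closure, `a ↦ α(g) a + β(g)`. -/
def affineAct (α β : G → k) (g : G) (a : AlgebraicClosure k) : AlgebraicClosure k :=
  algebraMap k (AlgebraicClosure k) (α g) * a + algebraMap k (AlgebraicClosure k) (β g)

/-- The regular orbits on a set `R`: the orbits of points of `R` on which no nontrivial
element of `G` has a fixed point. -/
def regularOrbits [Group G] (α β : G → k) (R : Set (AlgebraicClosure k)) :
    Set (Set (AlgebraicClosure k)) :=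
  {O | (∃ a ∈ R, O = Set.range fun g => affineAct α β g a) ∧
    ∀ a ∈ O, ∀ g : G, affineAct α β g a = a → g = 1}

end AffineAction

section Genus

variable (k F : Type*) [Field k] [Field F] [Algebra k F]

/-- The differentials of `F/k` that are regular at every closed point of the complete nonsingular
curve with function field `F`. The closed points are the proper valuation subrings `A` of `F`
containing `k`; `A` is the local ring at the point, and a differential is regular there if it
is an `A`-linear combination of differentials `dt` with `t ∈ A`. -/
def regularDifferentials : Submodule k Ω[F⁄k] where
  carrier := {ω | ∀ A : ValuationSubring F, (∀ c : k, algebraMap k F c ∈ A) → A ≠ ⊤ →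
    ω ∈ Submodule.span A (KaehlerDifferential.D k F '' (A : Set F))}
  add_mem' h₁ h₂ A hA hA' := add_mem (h₁ A hA hA') (h₂ A hA hA')
  zero_mem' _ _ _ := zero_mem _
  smul_mem' c ω h A hA hA' := by
    have := Submodule.smul_mem _ (⟨algebraMap k F c, hA c⟩ : A) (h A hA hA')
    rwa [← algebraMap_smul F (⟨algebraMap k F c, hA c⟩ : A) ω, ValuationSubring.algebraMap_apply,
      algebraMap_smul] at this

/-- The genus of the complete nonsingular curve over `k` with function field `F`: the dimension of
its space of global regular differentials. (Used for smooth curves, for which this is the genus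
in every other sense too.) -/
def curveGenus : ℕ := Module.finrank k (regularDifferentials k F)

end Genus

end

/-! ### The affine coordinate ring is a Dedekind domain. -/

noncomputable section

/-! Two independent computations combine.

Genus of `Y² = f(X)`. The coordinate ring `B` is Dedekind, and `dX/Y` generates the differentials
regular on the affine part as a `B`-module. In the coordinates `1/X`, `Y/X^(g+1)` with `g = ⌊(deg f
- 1)/2⌋` the curve has an equation of the same kind. Comparing the two charts leaves exactly the
`p(X) dX/Y` with `deg p < g`, so the genus is `g` (`regularDifferentials_eq`,
`curveGenus_of_sq_eq_aeval`).

Equation of the quotient. If `ι ∈ G`, an invariant function has no `Y`-part and `k(C)^G = k(t)` is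
rational. If `ι ∉ G`, then `G` acts faithfully on `k[X]`; the invariants are `k[t]` with `deg t =
|G|`, and the fibres of `t` over the algebraic closure are the orbits. The semi-invariants of
character `γ⁻¹` are `u · k[t]` with `deg u < |G|`. Hence `k(C)^G = k(t, z)` with `z = uY` and `z² =
u² f = P(t)`, where the bound on `deg u` forces `P` to be separable. The genus is therefore `⌊(deg P
- 1)/2⌋`.

Each regular orbit in `R` gives one root of `P`. A nontrivial affine map fixes at most one point, so
a count in `G` shows that the points with nontrivial stabilizer form at most one orbit
(`mem_orbit_of_smul_eq`). That orbit gives a root of `P` exactly when `u` is non-constant, that is,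
when `γ` is nontrivial. So `deg P` is `r` for trivial `γ` and `r + 1` otherwise; the formulas in
`|R|` follow from `deg P · |G| = 2 deg u + |R|` and `r |G| ≤ |R|`. -/

theorem dvd_of_sq_dvd_sq_mul_of_squarefree {K : Type*} [Field K] {q u f : K[X]}
    (hf : Squarefree f) (h : q ^ 2 ∣ u ^ 2 * f) : q ∣ u := by
  classical
  rcases eq_or_ne q 0 with rfl | hq
  · have : u ^ 2 * f = 0 := by simpa using h
    rcases mul_eq_zero.mp this with h | h
    · simpa using h
    · exact absurd h hf.ne_zero
  have hd : EuclideanDomain.gcd q u ≠ 0 := fun h0 => hq (EuclideanDomain.gcd_eq_zero_iff.mp h0).1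
  obtain ⟨q', hq'⟩ := EuclideanDomain.gcd_dvd_left q u
  obtain ⟨u', hu'⟩ := EuclideanDomain.gcd_dvd_right q u
  set d := EuclideanDomain.gcd q u
  have hcop : IsCoprime q' u' := by
    refine ⟨EuclideanDomain.gcdA q u, EuclideanDomain.gcdB q u, mul_left_cancel₀ hd ?_⟩
    have := EuclideanDomain.gcd_eq_gcd_ab q u
    change d = _ at this
    linear_combination (-1 : K[X]) * this - EuclideanDomain.gcdA q u * hq' -
      EuclideanDomain.gcdB q u * hu'
  have h1 : q' ^ 2 ∣ u' ^ 2 * f := by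
    rw [hq', hu', mul_pow, mul_pow, mul_assoc] at h
    exact (mul_dvd_mul_iff_left (pow_ne_zero 2 hd)).mp h
  -- After removing the gcd, the whole square must divide `f`, so `q'` is a unit.
  have h2 : q' ^ 2 ∣ f := (hcop.pow (m := 2) (n := 2)).dvd_of_dvd_mul_left h1
  have h3 : IsUnit q' := hf q' (by rwa [← sq])
  rw [hq']
  exact (IsUnit.mul_right_dvd h3).mpr (EuclideanDomain.gcd_dvd_right q u)

/-- `z` is the image of the fraction `a / c`, and `k[X]` is integrally closed. -/
theorem exists_eq_algebraMap_of_isIntegral_of_mul_eq {k F : Type*} [Field k] [Field F]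
    [Algebra k[X] F] [FaithfulSMul k[X] F] {z : F} {a c : k[X]} (hc : c ≠ 0)
    (hz : IsIntegral k[X] z) (h : z * algebraMap k[X] F c = algebraMap k[X] F a) :
    ∃ q, z = algebraMap k[X] F q := by
  let := FractionRing.liftAlgebra k[X] F
  have hc' : algebraMap k[X] F c ≠ 0 := by
    rwa [Ne, FaithfulSMul.algebraMap_eq_zero_iff]
  have hz' : z = algebraMap (FractionRing k[X]) F
      (algebraMap k[X] (FractionRing k[X]) a / algebraMap k[X] (FractionRing k[X]) c) := by
    rw [map_div₀, ← IsScalarTower.algebraMap_apply, ← IsScalarTower.algebraMap_apply,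
      eq_div_iff hc', h]
  rw [hz', isIntegral_algebraMap_iff (FaithfulSMul.algebraMap_injective _ _)] at hz
  obtain ⟨q, hq⟩ := IsIntegrallyClosed.isIntegral_iff.mp hz
  exact ⟨q, by rw [hz', ← hq, ← IsScalarTower.algebraMap_apply]⟩

namespace HyperellipticCurve

variable {k : Type*} [Field k] (C : HyperellipticCurve k)

theorem exists_eq_add_mul_root (b : C.CoordinateRing) :
    ∃ p q : k[X], b = AdjoinRoot.of C.equation p +
      AdjoinRoot.of C.equation q * AdjoinRoot.root C.equation := by
  obtain ⟨g, rfl⟩ := AdjoinRoot.mk_surjective b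
  have hdeg : (g %ₘ C.equation).natDegree < 2 := by
    have := natDegree_modByMonic_lt g C.equation_monic
      (fun h => by have := C.equation_natDegree; rw [h] at this; simp at this)
    rwa [C.equation_natDegree] at this
  refine ⟨(g %ₘ C.equation).coeff 0, (g %ₘ C.equation).coeff 1, ?_⟩
  have h1 : AdjoinRoot.mk C.equation g = AdjoinRoot.mk C.equation (g %ₘ C.equation) := by
    rw [AdjoinRoot.mk_eq_mk]
    refine ⟨g /ₘ C.equation, ?_⟩
    linear_combination (-1 : k[X][X]) * modByMonic_add_div g C.equation
  rw [h1]
  conv_lhs => rw [eq_X_add_C_of_natDegree_le_one (Nat.le_of_lt_succ hdeg)]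
  rw [map_add, map_mul, AdjoinRoot.mk_X, AdjoinRoot.mk_C, AdjoinRoot.mk_C, add_comm]

theorem add_mul_root_eq_zero {p q : k[X]} (h : AdjoinRoot.of C.equation p +
    AdjoinRoot.of C.equation q * AdjoinRoot.root C.equation = 0) : p = 0 ∧ q = 0 := by
  have h1 : AdjoinRoot.mk C.equation (Polynomial.C q * X + Polynomial.C p) = 0 := by
    rw [map_add, map_mul, AdjoinRoot.mk_X, AdjoinRoot.mk_C, AdjoinRoot.mk_C, add_comm]
    exact h
  have h2 : Polynomial.C q * X + Polynomial.C p = 0 := by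
    by_contra h0
    refine AdjoinRoot.mk_ne_zero_of_natDegree_lt C.equation_monic h0 ?_ h1
    rw [C.equation_natDegree]
    exact lt_of_le_of_lt natDegree_linear_le one_lt_two
  exact ⟨by simpa using congrArg (coeff · 0) h2, by simpa using congrArg (coeff · 1) h2⟩

theorem of_injective : Function.Injective (AdjoinRoot.of C.equation) := by
  rw [injective_iff_map_eq_zero]
  intro p hp
  exact (C.add_mul_root_eq_zero (p := p) (q := 0) (by simp [hp])).1

instance : FaithfulSMul k[X] C.CoordinateRing :=
  (faithfulSMul_iff_algebraMap_injective _ _).mpr C.of_injective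

theorem root_ne_zero : AdjoinRoot.root C.equation ≠ 0 := fun h =>
  one_ne_zero (C.add_mul_root_eq_zero (p := 0) (q := 1) (by simp [h])).2

instance : Module.Finite k[X] C.CoordinateRing := C.equation_monic.finite_adjoinRoot

theorem norm_eq (p q : k[X]) :
    (AdjoinRoot.of C.equation p + AdjoinRoot.of C.equation q * AdjoinRoot.root C.equation) *
      (AdjoinRoot.of C.equation p - AdjoinRoot.of C.equation q * AdjoinRoot.root C.equation) =
    AdjoinRoot.of C.equation (p ^ 2 - q ^ 2 * C.f) := by
  have := C.root_sq
  simp only [map_sub, map_pow, map_mul]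
  linear_combination (-AdjoinRoot.of C.equation q ^ 2) * this

/-- Multiplying by the conjugate `p - qY` turns a denominator `p + qY` into its norm, a nonzero
polynomial in `X`. -/
theorem exists_mul_eq {F : Type*} [Field F] [Algebra C.CoordinateRing F]
    [IsFractionRing C.CoordinateRing F] (x : F) :
    ∃ p q c : k[X], c ≠ 0 ∧ x * algebraMap C.CoordinateRing F (AdjoinRoot.of C.equation c) =
      algebraMap C.CoordinateRing F (AdjoinRoot.of C.equation p +
        AdjoinRoot.of C.equation q * AdjoinRoot.root C.equation) := by
  obtain ⟨n, d, hd, rfl⟩ := IsFractionRing.div_surjective (A := C.CoordinateRing) x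
  have hd0 : d ≠ 0 := nonZeroDivisors.ne_zero hd
  obtain ⟨p, q, rfl⟩ := C.exists_eq_add_mul_root d
  obtain ⟨p', q', hn⟩ := C.exists_eq_add_mul_root
    (n * (AdjoinRoot.of C.equation p - AdjoinRoot.of C.equation q * AdjoinRoot.root C.equation))
  have hc : AdjoinRoot.of C.equation p -
      AdjoinRoot.of C.equation q * AdjoinRoot.root C.equation ≠ 0 := by
    intro h
    obtain ⟨rfl, hq⟩ := C.add_mul_root_eq_zero (p := p) (q := -q) (by rw [← h]; simp; ring)
    exact hd0 (by simp [neg_eq_zero.mp hq])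
  refine ⟨p', q', p ^ 2 - q ^ 2 * C.f, fun h0 => ?_, ?_⟩
  · have := C.norm_eq p q
    rw [h0, map_zero] at this
    exact (mul_ne_zero hd0 hc) this
  · have h1 : algebraMap C.CoordinateRing F (AdjoinRoot.of C.equation p +
        AdjoinRoot.of C.equation q * AdjoinRoot.root C.equation) ≠ 0 := by
      rwa [Ne, FaithfulSMul.algebraMap_eq_zero_iff]
    rw [← hn, ← C.norm_eq, map_mul, map_mul]
    field_simp

variable (h2 : (2 : k) ≠ 0)
include h2

/-- Write an integral `x` as `(p + qY)/c`. Its trace `2p/c` is integral over `k[X]`, hence a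
polynomial, and `2` is invertible, so `p = ca`. Then `(x - a)² = q²f/c²` is also a polynomial, and
squarefreeness of `f` gives `c ∣ q`. -/
theorem isIntegrallyClosed : IsIntegrallyClosed C.CoordinateRing := by
  rw [isIntegrallyClosed_iff C.FunctionField]
  intro x hx
  have hx : IsIntegral k[X] x := isIntegral_trans x hx
  obtain ⟨p, q, c, hc, h⟩ := C.exists_mul_eq x
  have hinv : ∀ b : C.CoordinateRing, C.involution (algebraMap _ C.FunctionField b) =
      algebraMap _ _ (C.negHom b) := fun b =>
    IsFractionRing.fieldEquivOfAlgEquiv_algebraMap _ _ _ _ _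
  have halg : ∀ a : k[X], algebraMap k[X] C.FunctionField a =
      algebraMap C.CoordinateRing _ (AdjoinRoot.of C.equation a) := fun a =>
    IsScalarTower.algebraMap_apply k[X] C.CoordinateRing C.FunctionField a
  let σ : C.FunctionField →ₐ[k[X]] C.FunctionField :=
    { (C.involution : C.FunctionField →+* C.FunctionField) with
      commutes' := fun a => by
        rw [halg]
        exact (hinv _).trans (congrArg _ (C.negHom.commutes a)) }
  have hσ : ∀ b : C.CoordinateRing, σ (algebraMap _ _ b) = algebraMap _ _ (C.negHom b) := hinv
  have hneg : ∀ a : k[X], C.negHom (AdjoinRoot.of C.equation a) = AdjoinRoot.of C.equation a :=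
    C.negHom.commutes
  have hσx := congrArg σ h
  rw [map_mul, hσ, hσ, hneg, map_add, map_mul, hneg, hneg, C.negHom_root] at hσx
  have hc' : algebraMap k[X] C.FunctionField c ≠ 0 := by
    rwa [Ne, FaithfulSMul.algebraMap_eq_zero_iff]
  have h2' : (2 : k[X]) * Polynomial.C (2⁻¹ : k) = 1 := by
    rw [← map_ofNat Polynomial.C 2, ← map_mul, mul_inv_cancel₀ h2, map_one]
  obtain ⟨e, he⟩ := exists_eq_algebraMap_of_isIntegral_of_mul_eq (z := x + σ x) (a := 2 * p) hc
    (hx.add (hx.map σ)) (by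
      rw [halg, halg, add_mul, h, hσx, ← map_add, map_mul]
      congr 1
      rw [map_ofNat]
      ring)
  have hpe : c * (Polynomial.C (2⁻¹ : k) * e) = p := by
    apply FaithfulSMul.algebraMap_injective k[X] C.FunctionField
    have h3 : algebraMap k[X] C.FunctionField e * algebraMap k[X] C.FunctionField c =
        algebraMap k[X] C.FunctionField (2 * p) := by
      rw [← he, halg, halg, add_mul, h, hσx, ← map_add, map_mul]
      congr 1
      rw [map_ofNat]
      ring
    rw [← map_mul] at h3
    have h4 := FaithfulSMul.algebraMap_injective k[X] C.FunctionField h3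
    congr 1
    linear_combination Polynomial.C (2⁻¹ : k) * h4 + p * h2'
  generalize Polynomial.C (2⁻¹ : k) * e = a at hpe
  have hy : algebraMap C.CoordinateRing C.FunctionField (AdjoinRoot.root C.equation) ^ 2 =
      algebraMap k[X] C.FunctionField C.f := by
    rw [← map_pow, C.root_sq, halg]
  rw [← hpe] at h
  simp only [map_add, map_mul, ← halg] at h
  have hxa : (x - algebraMap k[X] C.FunctionField a) ^ 2 * algebraMap k[X] C.FunctionField (c ^ 2) =
      algebraMap k[X] C.FunctionField (q ^ 2 * C.f) := by
    rw [map_pow, ← mul_pow, map_mul, map_pow, ← hy, ← mul_pow]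
    congr 1
    linear_combination h
  obtain ⟨w, hw⟩ := exists_eq_algebraMap_of_isIntegral_of_mul_eq (pow_ne_zero 2 hc)
    ((hx.sub isIntegral_algebraMap).pow 2) hxa
  rw [hw, ← map_mul] at hxa
  have hdvd : c ^ 2 ∣ q ^ 2 * C.f :=
    ⟨w, by
      rw [mul_comm (c ^ 2)]
      exact (FaithfulSMul.algebraMap_injective k[X] C.FunctionField hxa).symm⟩
  obtain ⟨b, rfl⟩ := dvd_of_sq_dvd_sq_mul_of_squarefree C.separable.squarefree hdvd
  refine ⟨AdjoinRoot.of C.equation a + AdjoinRoot.of C.equation b * AdjoinRoot.root C.equation, ?_⟩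
  apply mul_right_cancel₀ hc'
  rw [h]
  simp only [map_add, map_mul, ← halg]
  ring

theorem isDedekindDomain : IsDedekindDomain C.CoordinateRing := by
  have := C.isIntegrallyClosed h2
  have : IsNoetherianRing C.CoordinateRing :=
    isNoetherian_of_tower k[X] (isNoetherian_of_isNoetherianRing_of_finite k[X] C.CoordinateRing)
  have : Ring.DimensionLEOne C.CoordinateRing := .of_isIntegral k[X] C.CoordinateRing
  exact { }

end HyperellipticCurve

/-! ### Differentials regular on the affine part. -/

namespace HyperellipticCurve

open IsDedekindDomain KaehlerDifferential

variable {k : Type*} [Field k] (C : HyperellipticCurve k) (F : Type*) [Field F] [Algebra k F]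
  [Algebra C.CoordinateRing F]

/-- The image of the coordinate `X` in a field over the coordinate ring. -/
def xIn : F := algebraMap C.CoordinateRing F (AdjoinRoot.of C.equation X)

/-- The image of the coordinate `Y` in a field over the coordinate ring. -/
def yIn : F := algebraMap C.CoordinateRing F (AdjoinRoot.root C.equation)

/-- The differential `dX / Y`. -/
def invDifferential : Ω[F⁄k] := (C.yIn F)⁻¹ • D k F (C.xIn F)

variable [IsScalarTower k C.CoordinateRing F]

theorem algebraMap_of (p : k[X]) :
    algebraMap C.CoordinateRing F (AdjoinRoot.of C.equation p) = aeval (C.xIn F) p := by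
  have : ((Algebra.ofId C.CoordinateRing F).restrictScalars k).comp
      (AdjoinRoot.ofAlgHom k C.equation) = aeval (C.xIn F) := by
    ext
    simp [xIn, Algebra.ofId_apply]
  exact DFunLike.congr_fun this p

theorem algebraMap_add_mul_root (p q : k[X]) :
    algebraMap C.CoordinateRing F (AdjoinRoot.of C.equation p +
      AdjoinRoot.of C.equation q * AdjoinRoot.root C.equation) =
    aeval (C.xIn F) p + aeval (C.xIn F) q * C.yIn F := by
  rw [map_add, map_mul, algebraMap_of, algebraMap_of, yIn]

theorem yIn_sq : C.yIn F ^ 2 = aeval (C.xIn F) C.f := by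
  rw [yIn, ← map_pow, C.root_sq, algebraMap_of]

variable [IsFractionRing C.CoordinateRing F]

omit [Algebra k F] [IsScalarTower k C.CoordinateRing F] in
theorem yIn_ne_zero : C.yIn F ≠ 0 := by
  rw [yIn, Ne, FaithfulSMul.algebraMap_eq_zero_iff]
  exact C.root_ne_zero

omit [IsScalarTower k C.CoordinateRing F] in
theorem D_xIn : D k F (C.xIn F) = C.yIn F • C.invDifferential F := by
  rw [invDifferential, smul_inv_smul₀ (C.yIn_ne_zero F)]

theorem xIn_transcendental : Transcendental k (C.xIn F) := by
  rw [transcendental_iff]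
  intro p hp
  rw [← algebraMap_of, FaithfulSMul.algebraMap_eq_zero_iff] at hp
  exact C.of_injective (hp.trans (map_zero _).symm)

theorem aeval_add_mul_yIn_eq_zero {p q : k[X]}
    (h : aeval (C.xIn F) p + aeval (C.xIn F) q * C.yIn F = 0) : p = 0 ∧ q = 0 := by
  rw [← algebraMap_add_mul_root, FaithfulSMul.algebraMap_eq_zero_iff] at h
  exact C.add_mul_root_eq_zero h

theorem exists_mul_aeval_eq (x : F) : ∃ p q c : k[X], c ≠ 0 ∧
    x * aeval (C.xIn F) c = aeval (C.xIn F) p + aeval (C.xIn F) q * C.yIn F := by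
  obtain ⟨p, q, c, hc, h⟩ := C.exists_mul_eq x
  exact ⟨p, q, c, hc, by rw [← algebraMap_of, h, algebraMap_add_mul_root]⟩

variable (h2 : (2 : k) ≠ 0)
include h2

/-- Differentiate `Y² = f` to get `2Y dY = f' dX` and cancel `2Y`. -/
theorem D_yIn : D k F (C.yIn F) =
    aeval (C.xIn F) (Polynomial.C (2⁻¹ : k) * derivative C.f) • C.invDifferential F := by
  have h := congrArg (D k F) (C.yIn_sq F)
  rw [Derivation.leibniz_pow, Derivation.map_aeval, D_xIn] at h
  have h2F : (2 : F) ≠ 0 := by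
    rw [← map_ofNat (algebraMap k F) 2]
    exact (_root_.map_ne_zero _).mpr h2
  have h3 : (2 * C.yIn F) • D k F (C.yIn F) = (2 * C.yIn F) •
      aeval (C.xIn F) (Polynomial.C (2⁻¹ : k) * derivative C.f) • C.invDifferential F := by
    have h4 : (2 * C.yIn F) • D k F (C.yIn F) = 2 • C.yIn F ^ (2 - 1) • D k F (C.yIn F) := by
      simp only [Nat.add_one_sub_one, pow_one, ← Nat.cast_smul_eq_nsmul F, smul_smul, Nat.cast_ofNat]
    rw [h4, h, smul_smul, smul_smul, map_mul, aeval_C, map_inv₀, map_ofNat]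
    congr 1
    field_simp
  exact smul_right_injective _ (mul_ne_zero h2F (C.yIn_ne_zero F)) h3

/-- Both `dX = Y · dX/Y` and `dY = (f'/2) · dX/Y` are integral multiples of `dX/Y`, so the Leibniz
rule applies. -/
theorem D_algebraMap (b : C.CoordinateRing) : ∃ b' : C.CoordinateRing,
    D k F (algebraMap _ F b) = algebraMap _ F b' • C.invDifferential F := by
  obtain ⟨p, q, rfl⟩ := C.exists_eq_add_mul_root b
  refine ⟨AdjoinRoot.of C.equation (derivative q * C.f + q * (Polynomial.C (2⁻¹ : k) *
    derivative C.f)) + AdjoinRoot.of C.equation (derivative p) * AdjoinRoot.root C.equation, ?_⟩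
  rw [algebraMap_add_mul_root, algebraMap_add_mul_root, map_add, Derivation.leibniz,
    Derivation.map_aeval, Derivation.map_aeval, D_yIn C F h2, D_xIn, map_add, map_mul _ _ C.f,
    ← yIn_sq, map_mul _ q]
  simp only [smul_smul, ← add_smul]
  congr 1
  ring

theorem exists_eq_smul_invDifferential (ω : Ω[F⁄k]) : ∃ φ : F, ω = φ • C.invDifferential F := by
  have hω : ω ∈ Submodule.span F {C.invDifferential F} := by
    have : (⊤ : Submodule F Ω[F⁄k]) ≤ Submodule.span F {C.invDifferential F} := by
      rw [← span_range_derivation k F, Submodule.span_le]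
      rintro _ ⟨x, rfl⟩
      obtain ⟨n, d, hd, rfl⟩ := IsFractionRing.div_surjective (A := C.CoordinateRing) x
      obtain ⟨n', hn⟩ := C.D_algebraMap F h2 n
      obtain ⟨d', hd'⟩ := C.D_algebraMap F h2 d
      rw [SetLike.mem_coe, Derivation.leibniz_div, hn, hd']
      exact Submodule.smul_mem _ _ (Submodule.sub_mem _
        (Submodule.smul_mem _ _ (Submodule.smul_mem _ _ (Submodule.mem_span_singleton_self _)))
        (Submodule.smul_mem _ _ (Submodule.smul_mem _ _ (Submodule.mem_span_singleton_self _))))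
    exact this trivial
  obtain ⟨φ, h⟩ := Submodule.mem_span_singleton.mp hω
  exact ⟨φ, h.symm⟩

/-- Otherwise all differentials vanish and `F/k` is unramified; being essentially of finite type it
is then finite, although `X` is transcendental. -/
theorem invDifferential_ne_zero : C.invDifferential F ≠ 0 := by
  intro h
  have h1 : Subsingleton Ω[F⁄k] := by
    refine subsingleton_of_forall_eq 0 fun ω => ?_
    obtain ⟨φ, rfl⟩ := C.exists_eq_smul_invDifferential F h2 ω
    rw [h, smul_zero]
  have : Algebra.FormallyUnramified k F := ⟨h1⟩
  have : Algebra.FiniteType k C.CoordinateRing :=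
    Algebra.FiniteType.trans (S := k[X]) inferInstance inferInstance
  have : Algebra.EssFiniteType C.CoordinateRing F :=
    .of_isLocalization F (nonZeroDivisors C.CoordinateRing)
  have : Algebra.EssFiniteType k F := .comp k C.CoordinateRing F
  have : Module.Finite k F := Algebra.FormallyUnramified.finite_of_free k F
  exact C.xIn_transcendental F (Algebra.IsAlgebraic.isAlgebraic _)

/-- A Dedekind domain is the intersection of its localizations at height-one primes. In each such
valuation ring `A`, elements are fractions with unit denominators, so the differentials of `A` lie
in `A · dX/Y`, and the coefficient of `ω` lies in `A`. -/
theorem exists_of_mem_regularDifferentials {ω : Ω[F⁄k]} (hω : ω ∈ regularDifferentials k F) :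
    ∃ b : C.CoordinateRing, ω = algebraMap _ F b • C.invDifferential F := by
  have := C.isDedekindDomain h2
  obtain ⟨φ, rfl⟩ := C.exists_eq_smul_invDifferential F h2 ω
  suffices φ ∈ (algebraMap C.CoordinateRing F).range by
    obtain ⟨b, rfl⟩ := this
    exact ⟨b, rfl⟩
  refine HeightOneSpectrum.mem_integers_of_valuation_le_one F φ fun v => ?_
  have hmem : ∀ b : C.CoordinateRing, algebraMap _ F b ∈ (v.valuation F).valuationSubring :=
    fun b => v.valuation_le_one b
  have hkey : Submodule.span (v.valuation F).valuationSubring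
      (D k F '' ((v.valuation F).valuationSubring : Set F)) ≤
      Submodule.span (v.valuation F).valuationSubring {C.invDifferential F} := by
    rw [Submodule.span_le]
    rintro _ ⟨x, hx, rfl⟩
    obtain ⟨n, d, hnd⟩ := v.exists_primeCompl_mul_eq_of_integer x
      ((v.valuation F).mem_valuationSubring_iff x |>.mp hx)
    have hd1 : v.valuation F (algebraMap _ F (d : C.CoordinateRing)) = 1 :=
      v.valuation_eq_one_iff_notMem.mpr d.2
    have hd0 : algebraMap _ F (d : C.CoordinateRing) ≠ 0 := fun h => by simp [h] at hd1
    have hdinv : (algebraMap _ F (d : C.CoordinateRing))⁻¹ ∈ (v.valuation F).valuationSubring := by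
      rw [Valuation.mem_valuationSubring_iff, map_inv₀, hd1, inv_one]
    obtain ⟨n', hn⟩ := C.D_algebraMap F h2 n
    obtain ⟨d', hd'⟩ := C.D_algebraMap F h2 d
    have hD := congrArg (D k F) hnd
    rw [Derivation.leibniz, hn, hd'] at hD
    have hDx : D k F x = ((algebraMap _ F (d : C.CoordinateRing))⁻¹ *
        (algebraMap _ F n' - x * algebraMap _ F d')) • C.invDifferential F := by
      rw [mul_smul, sub_smul, ← hD, mul_smul, add_sub_cancel_left, inv_smul_smul₀ hd0]
    rw [SetLike.mem_coe, hDx, Submodule.mem_span_singleton]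
    exact ⟨⟨_, mul_mem hdinv (sub_mem (hmem n') (mul_mem hx (hmem d')))⟩, rfl⟩
  have h := hkey (hω _ (fun c => ?_) ?_)
  · obtain ⟨a, ha⟩ := Submodule.mem_span_singleton.mp h
    have : (a : F) = φ := smul_left_injective F (C.invDifferential_ne_zero F h2) ha
    rw [← this]
    exact (v.valuation F).mem_valuationSubring_iff _ |>.mp a.2
  · rw [IsScalarTower.algebraMap_apply k C.CoordinateRing F]
    exact hmem _
  · intro htop
    obtain ⟨π, hπ⟩ := v.valuation_exists_uniformizer F
    have h1 : π⁻¹ ∈ (v.valuation F).valuationSubring := htop ▸ trivial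
    rw [Valuation.mem_valuationSubring_iff, map_inv₀, hπ, ← WithZero.exp_neg, neg_neg] at h1
    exact absurd h1 (by decide)

end HyperellipticCurve

/-! ### The chart at infinity and the genus of `Y² = f(X)`. -/

theorem aeval_inv_reflect_mul_pow {k K : Type*} [Field k] [Field K] [Algebra k K] {x : K}
    (hx : x ≠ 0) {N : ℕ} {p : k[X]} (hp : p.natDegree ≤ N) :
    aeval x⁻¹ (p.reflect N) * x ^ N = aeval x p := by
  let := invertibleOfNonzero hx
  have := eval₂_reflect_mul_pow (algebraMap k K) x N p hp
  rwa [invOf_eq_inv] at this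

/-- Euler's relation for the homogenization of `p` in degree `N + 1`, dehomogenized at the other
variable. -/
theorem X_mul_derivative_reflect {k : Type*} [Field k] {N : ℕ} {p : k[X]}
    (hp : p.natDegree ≤ N + 1) :
    X * derivative (p.reflect (N + 1)) + (derivative p).reflect N =
      ((N + 1 : ℕ) : k[X]) * p.reflect (N + 1) := by
  ext i
  rw [coeff_add, coeff_reflect, ← C_eq_natCast, coeff_C_mul, coeff_reflect, coeff_derivative]
  rcases Nat.lt_or_ge (N + 1) i with hi | hi
  · obtain ⟨j, rfl⟩ : ∃ j, i = j + 1 := ⟨i - 1, by omega⟩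
    rw [revAt_eq_self_of_lt hi, revAt_eq_self_of_lt (by omega), coeff_X_mul, coeff_derivative,
      coeff_reflect, revAt_eq_self_of_lt hi, coeff_eq_zero_of_natDegree_lt (by omega),
      coeff_eq_zero_of_natDegree_lt (by omega)]
    simp
  · rw [revAt_le hi]
    rcases Nat.eq_zero_or_pos i with rfl | hi0
    · simp [mul_comm]
    · obtain ⟨j, rfl⟩ : ∃ j, i = j + 1 := ⟨i - 1, by omega⟩
      rw [coeff_X_mul, coeff_derivative, coeff_reflect, revAt_le hi]
      rcases Nat.lt_or_ge N (j + 1) with h | h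
      · obtain rfl : j = N := by omega
        rw [revAt_eq_self_of_lt h, coeff_eq_zero_of_natDegree_lt (n := j + 1 + 1) (by omega)]
        simp [mul_comm]
      · rw [revAt_le h, show N - (j + 1) + 1 = N + 1 - (j + 1) by omega]
        push_cast [Nat.cast_sub h]
        ring

/-- By Euler's relation a multiple root `a ≠ 0` would make `a⁻¹` a multiple root of `p`. At `0`
either the value or the derivative is the leading coefficient of `p`, as `deg p` is `N + 1` or `N`.
-/
theorem separable_reflect {k : Type*} [Field k] {N : ℕ} {p : k[X]} (hp : p.Separable)
    (h1 : p.natDegree ≤ N + 1) (h2 : N ≤ p.natDegree) (h0 : 0 < p.natDegree) :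
    (p.reflect (N + 1)).Separable := by
  refine (isCoprime_iff_aeval_ne_zero_of_isAlgClosed k (AlgebraicClosure k) _ _).mpr fun a => ?_
  rcases eq_or_ne a 0 with rfl | ha
  · have hlead : p.leadingCoeff ≠ 0 := leadingCoeff_ne_zero.mpr (by rintro rfl; simp at h0)
    simp only [← coeff_zero_eq_aeval_zero', coeff_derivative, coeff_reflect, revAt_zero,
      revAt_le (show 0 + 1 ≤ N + 1 by omega)]
    rcases Nat.lt_or_ge N p.natDegree with h | h
    · left
      rw [show N + 1 = p.natDegree by omega]
      simpa using hlead
    · right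
      rw [show N + 1 - (0 + 1) = p.natDegree by omega]
      simpa using hlead
  · by_contra! h
    obtain ⟨ha0, ha1⟩ := h
    have h3 := congrArg (aeval a) (X_mul_derivative_reflect h1)
    rw [map_add, map_mul, ha1, mul_zero, zero_add, map_mul, ha0, mul_zero] at h3
    have h4 := aeval_inv_reflect_mul_pow (inv_ne_zero ha) h1
    have h5 := aeval_inv_reflect_mul_pow (inv_ne_zero ha)
      (natDegree_derivative_le p |>.trans (by omega : _ ≤ N))
    rw [inv_inv, ha0, zero_mul] at h4
    rw [inv_inv, h3, zero_mul] at h5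
    have := (isCoprime_iff_aeval_ne_zero_of_isAlgClosed k (AlgebraicClosure k) _ _).mp hp a⁻¹
    exact this.elim (· h4.symm) (· h5.symm)

namespace HyperellipticCurve

open IsDedekindDomain KaehlerDifferential

variable {k : Type*} [Field k] (C : HyperellipticCurve k)

/-- The number `⌊(deg f - 1) / 2⌋`. -/
def genus : ℕ := (C.f.natDegree - 1) / 2

theorem two_mul_genus_lt : 2 * C.genus + 1 ≤ C.f.natDegree := by
  have := C.natDegree_pos
  unfold genus
  omega

theorem natDegree_le_two_mul_genus : C.f.natDegree ≤ 2 * C.genus + 1 + 1 := by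
  unfold genus
  omega

/-- The equation of the curve in the coordinates `1 / X` and `Y / X ^ (g + 1)`. -/
def atInfinity : HyperellipticCurve k where
  f := C.f.reflect (2 * C.genus + 1 + 1)
  natDegree_pos := by
    rw [Nat.pos_iff_ne_zero]
    intro h
    have hle := C.natDegree_le_two_mul_genus
    have h0 : ∀ i, 0 < i → i ≤ 2 * C.genus + 1 + 1 → C.f.coeff (2 * C.genus + 1 + 1 - i) = 0 := by
      intro i hi hi'
      rw [← revAt_le hi', ← coeff_reflect]
      exact coeff_eq_zero_of_natDegree_lt (by omega)
    -- By `h0`, all coefficients of `f` below index `2g + 2` vanish. This contradicts squarefreeness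
    -- when `deg f ≥ 2`; when `deg f = 1` it kills the leading coefficient.
    have hX : X ^ 2 ∣ C.f ∨ C.f.natDegree = 1 := by
      rcases Nat.eq_or_lt_of_le (Nat.succ_le_of_lt C.natDegree_pos) with h1 | h1
      · exact .inr h1.symm
      · left
        rw [X_pow_dvd_iff]
        intro d hd
        have := h0 (2 * C.genus + 1 + 1 - d) (by omega) (by omega)
        rwa [show 2 * C.genus + 1 + 1 - (2 * C.genus + 1 + 1 - d) = d by omega] at this
    rcases hX with hX | hX
    · exact not_isUnit_X (C.separable.squarefree X (by rwa [← sq]))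
    · have := h0 (2 * C.genus + 1 + 1 - 1) (by omega) (by omega)
      rw [show 2 * C.genus + 1 + 1 - (2 * C.genus + 1 + 1 - 1) = C.f.natDegree by omega,
        coeff_natDegree, leadingCoeff_eq_zero] at this
      simp [this] at hX
  separable := separable_reflect C.separable C.natDegree_le_two_mul_genus C.two_mul_genus_lt
    C.natDegree_pos

section Lift

variable {F : Type*} [Field F] [Algebra k F] {t z : F}

/-- The evaluation of the coordinate ring at a point of the curve. -/
def liftHom (hz : z ^ 2 = aeval t C.f) : C.CoordinateRing →ₐ[k] F :=
  AdjoinRoot.liftAlgHom C.equation (aeval t : k[X] →ₐ[k] F) z (by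
    have h : ∀ p : k[X][X], p = X ^ 2 - Polynomial.C C.f →
        p.eval₂ ((aeval t : k[X] →ₐ[k] F) : k[X] →+* F) z = z ^ 2 - aeval t C.f := by
      rintro p rfl
      simp
    exact (h _ rfl).trans (by rw [hz, sub_self]))

variable (hz : z ^ 2 = aeval t C.f)

theorem liftHom_of (p : k[X]) : C.liftHom hz (AdjoinRoot.of C.equation p) = aeval t p :=
  AdjoinRoot.liftAlgHom_of _ _ _ _ _

theorem liftHom_root : C.liftHom hz (AdjoinRoot.root C.equation) = z :=
  AdjoinRoot.liftAlgHom_root _ _ _ _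

/-- The norm of a kernel element is a polynomial vanishing at the transcendental `t`, hence zero; in
a domain the element or its conjugate is then zero. -/
theorem liftHom_injective (ht : Transcendental k t) : Function.Injective (C.liftHom hz) := by
  rw [injective_iff_map_eq_zero]
  intro b hb
  obtain ⟨p, q, rfl⟩ := C.exists_eq_add_mul_root b
  have h : p ^ 2 - q ^ 2 * C.f = 0 := by
    have := congrArg (C.liftHom hz) (C.norm_eq p q)
    rw [map_mul, hb, zero_mul, liftHom_of] at this
    exact transcendental_iff.mp ht _ this.symm
  have h' := C.norm_eq p q
  rw [h, map_zero, mul_eq_zero] at h'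
  rcases h' with h' | h'
  · exact h'
  · obtain ⟨rfl, hq⟩ := C.add_mul_root_eq_zero (p := p) (q := -q) (by rw [← h', map_neg]; ring)
    simp [neg_eq_zero.mp hq]

theorem isFractionRing_liftHom (ht : Transcendental k t)
    (hgen : IntermediateField.adjoin k {t, z} = ⊤) :
    @IsFractionRing C.CoordinateRing _ F _ (C.liftHom hz).toAlgebra := by
  let := (C.liftHom hz).toAlgebra
  have : FaithfulSMul C.CoordinateRing F :=
    (faithfulSMul_iff_algebraMap_injective _ _).mpr (C.liftHom_injective hz ht)
  refine IsFractionRing.of_field _ _ fun x => ?_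
  have hx : x ∈ IntermediateField.adjoin k {t, z} := hgen ▸ trivial
  have hle : Algebra.adjoin k {t, z} ≤ (C.liftHom hz).range := by
    rw [Algebra.adjoin_le_iff]
    rintro _ (rfl | rfl)
    · exact ⟨AdjoinRoot.of _ X, by
        rw [AlgHom.toRingHom_eq_coe, RingHom.coe_coe, liftHom_of, aeval_X]⟩
    · exact ⟨AdjoinRoot.root _, C.liftHom_root hz⟩
  obtain ⟨r, hr, s, hs, rfl⟩ := IntermediateField.mem_adjoin_iff_div.mp hx
  obtain ⟨r', rfl⟩ := hle hr
  obtain ⟨s', rfl⟩ := hle hs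
  exact ⟨r', s', rfl⟩

end Lift

variable (F : Type*) [Field F] [Algebra k F] [Algebra C.CoordinateRing F]
  [IsScalarTower k C.CoordinateRing F] [IsFractionRing C.CoordinateRing F] (h2 : (2 : k) ≠ 0)

include h2 in
-- A Bézout relation `a f + b f' = 1` gives `dX/Y = aY dX + 2b dY`, with all coefficients in `A`.
theorem invDifferential_mem_span {A : ValuationSubring F} (hA : ∀ c : k, algebraMap k F c ∈ A)
    (hx : C.xIn F ∈ A) : C.invDifferential F ∈ Submodule.span A (D k F '' (A : Set F)) := by
  have haeval : ∀ p : k[X], aeval (C.xIn F) p ∈ A := by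
    intro p
    rw [aeval_eq_sum_range]
    refine sum_mem fun i _ => ?_
    rw [Algebra.smul_def]
    exact mul_mem (hA _) (pow_mem hx i)
  have hy : C.yIn F ∈ A := by
    rcases A.mem_or_inv_mem (C.yIn F) with h | h
    · exact h
    · have := mul_mem h (C.yIn_sq F ▸ haeval C.f : C.yIn F ^ 2 ∈ A)
      rwa [sq, inv_mul_cancel_left₀ (C.yIn_ne_zero F)] at this
  obtain ⟨a, b, hab⟩ := C.separable
  have key : C.invDifferential F = (aeval (C.xIn F) a * C.yIn F) • D k F (C.xIn F) +
      aeval (C.xIn F) (Polynomial.C 2 * b) • D k F (C.yIn F) := by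
    rw [C.D_yIn F h2, C.D_xIn, smul_smul, smul_smul, ← add_smul, mul_assoc, ← sq, C.yIn_sq,
      ← map_mul, ← map_mul, ← map_add]
    have : a * C.f + Polynomial.C 2 * b * (Polynomial.C 2⁻¹ * derivative C.f) = 1 := by
      have h : (Polynomial.C (2 : k)) * Polynomial.C 2⁻¹ = 1 := by
        rw [← map_mul, mul_inv_cancel₀ h2, map_one]
      linear_combination hab + b * derivative C.f * h
    rw [this, map_one, one_smul]
  rw [key]
  exact add_mem
    (Submodule.smul_mem _ (⟨_, mul_mem (haeval a) hy⟩ : A) (Submodule.subset_span ⟨_, hx, rfl⟩))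
    (Submodule.smul_mem _ (⟨_, haeval _⟩ : A) (Submodule.subset_span ⟨_, hy, rfl⟩))

theorem xIn_ne_zero : C.xIn F ≠ 0 := fun h =>
  C.xIn_transcendental F (h ▸ isAlgebraic_zero)

/-- The integral differentials `p(X) dX / Y`. -/
def differentialMap : k[X] →ₗ[k] Ω[F⁄k] :=
  ((LinearMap.toSpanSingleton F Ω[F⁄k] (C.invDifferential F)).restrictScalars k).comp
    (aeval (C.xIn F)).toLinearMap

omit [IsScalarTower k C.CoordinateRing F] [IsFractionRing C.CoordinateRing F] in
theorem differentialMap_apply (p : k[X]) :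
    C.differentialMap F p = aeval (C.xIn F) p • C.invDifferential F := rfl

include h2 in
theorem differentialMap_injective : Function.Injective (C.differentialMap F) := by
  rw [injective_iff_map_eq_zero]
  intro p hp
  rw [differentialMap_apply, smul_eq_zero_iff_left (C.invDifferential_ne_zero F h2)] at hp
  exact transcendental_iff.mp (C.xIn_transcendental F) p hp

/-- A field is the function field of a curve through the coordinates at infinity as well. -/
theorem exists_algebra_atInfinity : ∃ _ : Algebra C.atInfinity.CoordinateRing F,
    IsScalarTower k C.atInfinity.CoordinateRing F ∧ IsFractionRing C.atInfinity.CoordinateRing F ∧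
    C.atInfinity.xIn F = (C.xIn F)⁻¹ ∧
    C.atInfinity.yIn F = C.yIn F * (C.xIn F)⁻¹ ^ (C.genus + 1) := by
  have hx := C.xIn_ne_zero F
  have hz : (C.yIn F * (C.xIn F)⁻¹ ^ (C.genus + 1)) ^ 2 =
      aeval (C.xIn F)⁻¹ C.atInfinity.f := by
    rw [mul_pow, C.yIn_sq, ← aeval_inv_reflect_mul_pow hx C.natDegree_le_two_mul_genus,
      mul_assoc, ← pow_mul, show (C.genus + 1) * 2 = 2 * C.genus + 1 + 1 by ring, ← mul_pow,
      mul_inv_cancel₀ hx, one_pow, mul_one]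
    rfl
  have ht : Transcendental k (C.xIn F)⁻¹ := fun h =>
    C.xIn_transcendental F (by simpa using h.inv)
  have hgen : IntermediateField.adjoin k
      {(C.xIn F)⁻¹, C.yIn F * (C.xIn F)⁻¹ ^ (C.genus + 1)} = ⊤ := by
    set E := IntermediateField.adjoin k {(C.xIn F)⁻¹, C.yIn F * (C.xIn F)⁻¹ ^ (C.genus + 1)}
    have h1 : (C.xIn F)⁻¹ ∈ E := IntermediateField.subset_adjoin _ _ (by simp)
    have h2 : C.yIn F * (C.xIn F)⁻¹ ^ (C.genus + 1) ∈ E :=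
      IntermediateField.subset_adjoin _ _ (by simp)
    have hxE : C.xIn F ∈ E := by simpa using inv_mem h1
    have hyE : C.yIn F ∈ E := by
      have := mul_mem h2 (pow_mem hxE (C.genus + 1))
      rwa [mul_assoc, ← mul_pow, inv_mul_cancel₀ hx, one_pow, mul_one] at this
    have haeval : ∀ p : k[X], aeval (C.xIn F) p ∈ E := fun p => by
      rw [aeval_eq_sum_range]
      exact sum_mem fun i _ => E.smul_mem (pow_mem hxE i)
    rw [eq_top_iff]
    rintro x -
    obtain ⟨p, q, c, hc, h⟩ := C.exists_mul_aeval_eq F x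
    have hc' : aeval (C.xIn F) c ≠ 0 := fun h0 =>
      hc (transcendental_iff.mp (C.xIn_transcendental F) c h0)
    rw [← eq_div_iff hc'] at h
    rw [h]
    exact div_mem (add_mem (haeval p) (mul_mem (haeval q) hyE)) (haeval c)
  let := (C.atInfinity.liftHom hz).toAlgebra
  refine ⟨this, IsScalarTower.of_algHom _, C.atInfinity.isFractionRing_liftHom hz ht hgen, ?_,
    C.atInfinity.liftHom_root hz⟩
  exact (C.atInfinity.liftHom_of hz X).trans (aeval_X _)

include h2 in
-- The two generators differ by the factor `-X^(g-1)`. A differential regular in both charts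
-- satisfies `p + qY = -X^(g-1) (p'(1/X) + q'(1/X) Y/X^(g+1))`, which forces `q = 0` and `deg p <
-- g`. Conversely, every valuation ring contains `X` or `1/X`, so one of the charts applies.
theorem regularDifferentials_eq :
    regularDifferentials k F = (degreeLT k C.genus).map (C.differentialMap F) := by
  obtain ⟨_, _, _, hx', hy'⟩ := C.exists_algebra_atInfinity F
  have hx := C.xIn_ne_zero F
  have hη : C.atInfinity.invDifferential F =
      (-(C.xIn F ^ (C.genus + 1) * (C.xIn F)⁻¹ ^ 2)) • C.invDifferential F := by
    rw [invDifferential, invDifferential, hx', hy', Derivation.leibniz_inv, smul_smul, smul_smul]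
    congr 1
    rw [mul_inv, inv_pow, inv_pow, inv_inv]
    field_simp
  apply le_antisymm
  · intro ω hω
    obtain ⟨b, rfl⟩ := C.exists_of_mem_regularDifferentials F h2 hω
    obtain ⟨b', hb'⟩ := C.atInfinity.exists_of_mem_regularDifferentials F h2 hω
    rw [hη, smul_smul] at hb'
    replace hb' := smul_left_injective F (C.invDifferential_ne_zero F h2) hb'
    obtain ⟨p, q, rfl⟩ := C.exists_eq_add_mul_root b
    obtain ⟨p', q', rfl⟩ := C.atInfinity.exists_eq_add_mul_root b'
    rw [algebraMap_add_mul_root, algebraMap_add_mul_root, hx', hy'] at hb'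
    rw [algebraMap_add_mul_root]
    set M := max p'.natDegree q'.natDegree
    have hp' := aeval_inv_reflect_mul_pow (inv_ne_zero hx) (le_max_left _ _ : p'.natDegree ≤ M)
    have hq' := aeval_inv_reflect_mul_pow (inv_ne_zero hx) (le_max_right _ _ : q'.natDegree ≤ M)
    rw [inv_inv] at hp' hq'
    rw [← hp', ← hq'] at hb'
    -- Multiplying by `X^(M+2)` clears the negative powers: `M` for `p'(1/X)` and `q'(1/X)`, and `2`
    -- for the `Y`-part `q = -X⁻² q'(1/X)`.
    have hcomb : aeval (C.xIn F) (p * X ^ (M + 2) + p'.reflect M * X ^ (C.genus + 1)) +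
        aeval (C.xIn F) (q * X ^ (M + 2) + q'.reflect M) * C.yIn F = 0 := by
      simp only [map_add, map_mul, map_pow, aeval_X]
      rw [inv_pow, inv_pow, inv_pow] at hb'
      field_simp at hb'
      linear_combination hb'
    obtain ⟨h3, h4⟩ := C.aeval_add_mul_yIn_eq_zero F hcomb
    have hM : (p'.reflect M).natDegree ≤ M := natDegree_reflect_le.trans (by simp [M])
    have hM' : (q'.reflect M).natDegree ≤ M := natDegree_reflect_le.trans (by simp [M])
    obtain rfl : q = 0 := by
      by_contra hq
      have h5 : (q * X ^ (M + 2)).natDegree = (q'.reflect M).natDegree := by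
        rw [eq_neg_of_add_eq_zero_left h4, natDegree_neg]
      rw [natDegree_mul_X_pow _ hq] at h5
      omega
    refine ⟨p, ?_, by simp [differentialMap_apply]⟩
    rw [SetLike.mem_coe, mem_degreeLT]
    rcases eq_or_ne p 0 with rfl | hp
    · rw [degree_zero]
      exact WithBot.bot_lt_coe _
    · rw [degree_eq_natDegree hp, Nat.cast_lt]
      have h5 : (p * X ^ (M + 2)).natDegree = (p'.reflect M * X ^ (C.genus + 1)).natDegree := by
        rw [eq_neg_of_add_eq_zero_left h3, natDegree_neg]
      rw [natDegree_mul_X_pow _ hp] at h5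
      have h6 : (p'.reflect M * X ^ (C.genus + 1)).natDegree ≤ M + (C.genus + 1) :=
        natDegree_mul_le.trans (by simpa using hM)
      omega
  · rintro _ ⟨p, hp, rfl⟩
    intro A hA hA'
    by_cases hxA : C.xIn F ∈ A
    · have : aeval (C.xIn F) p ∈ A := by
        rw [aeval_eq_sum_range]
        refine sum_mem fun i _ => ?_
        rw [Algebra.smul_def]
        exact mul_mem (hA _) (pow_mem hxA i)
      exact Submodule.smul_mem _ (⟨_, this⟩ : A) (C.invDifferential_mem_span F h2 hA hxA)
    · have hxA' : (C.xIn F)⁻¹ ∈ A := (A.mem_or_inv_mem _).resolve_left hxA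
      have hmem := C.atInfinity.invDifferential_mem_span F h2 hA (hx' ▸ hxA')
      rw [differentialMap_apply, aeval_eq_sum_range, Finset.sum_smul]
      refine sum_mem fun i hi => ?_
      have hig : p.coeff i ≠ 0 → i < C.genus := fun h => by
        have := (le_degree_of_ne_zero h).trans_lt (mem_degreeLT.mp hp)
        exact_mod_cast this
      rcases eq_or_ne (p.coeff i) 0 with h0 | h0
      · rw [h0, zero_smul, zero_smul]
        exact zero_mem _
      · have hcoe : (p.coeff i • C.xIn F ^ i) • C.invDifferential F =
            (algebraMap k F (-p.coeff i) * (C.xIn F)⁻¹ ^ (C.genus - 1 - i)) •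
              C.atInfinity.invDifferential F := by
          rw [hη, smul_smul, Algebra.smul_def]
          congr 1
          have hg := hig h0
          rw [show C.genus + 1 = i + (C.genus - 1 - i) + 2 by omega, map_neg]
          generalize C.genus - 1 - i = m
          rw [inv_pow, inv_pow, pow_add, pow_add]
          field_simp
        rw [hcoe]
        exact Submodule.smul_mem _ (⟨_, mul_mem (hA _) (pow_mem hxA' _)⟩ : A) hmem

include C h2 in
theorem finite_regularDifferentials : Module.Finite k (regularDifferentials k F) := by
  rw [C.regularDifferentials_eq F h2]
  have : Module.Finite k (degreeLT k C.genus) := Module.Finite.equiv (degreeLTEquiv k _).symm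
  infer_instance

include h2 in
theorem curveGenus_eq : curveGenus k F = C.genus := by
  rw [curveGenus, C.regularDifferentials_eq F h2,
    ← (Submodule.equivMapOfInjective _ (C.differentialMap_injective F h2) _).finrank_eq,
    (degreeLTEquiv k _).finrank_eq, Module.finrank_fin_fun]

end HyperellipticCurve

/-- The genus of a function field generated by `t` and a square root of a separable polynomial in
`t`. -/
theorem curveGenus_of_sq_eq_aeval {k F : Type*} [Field k] [Field F] [Algebra k F]
    (h2 : (2 : k) ≠ 0) {t z : F} (ht : Transcendental k t) {P : k[X]} (hP : P.Separable)
    (hdeg : 0 < P.natDegree) (hz : z ^ 2 = aeval t P)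
    (hgen : IntermediateField.adjoin k {t, z} = ⊤) :
    Module.Finite k (regularDifferentials k F) ∧ curveGenus k F = (P.natDegree - 1) / 2 := by
  let C : HyperellipticCurve k := ⟨P, hdeg, hP⟩
  let := (C.liftHom hz).toAlgebra
  have : IsScalarTower k C.CoordinateRing F := IsScalarTower.of_algHom _
  have := C.isFractionRing_liftHom hz ht hgen
  exact ⟨C.finite_regularDifferentials F h2, C.curveGenus_eq F h2⟩

/-! ### Invariant and semi-invariant polynomials under affine substitutions. -/

section SemiInvariants

variable {k : Type*} [Field k] {G : Type*}

/-- The polynomial `α(g) X + β(g)`. -/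
def affinePoly (α β : G → k) (g : G) : k[X] := C (α g) * X + C (β g)

/-- The substitutions `X ↦ α(g) X + β(g)` define an action of `G` on `k[X]`. -/
structure IsAffineAction [Group G] (α β : G → k) : Prop where
  affine_one : affinePoly α β 1 = X
  affine_mul : ∀ g h, affinePoly α β (g * h) = (affinePoly α β h).comp (affinePoly α β g)

/-- Polynomials on which `G` acts through `χ`. -/
def IsSemiInvariant (α β χ : G → k) (p : k[X]) : Prop :=
  ∀ g, p.comp (affinePoly α β g) = C (χ g) * p

theorem natDegree_affinePoly {α β : G → k} {g : G} (h : α g ≠ 0) :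
    (affinePoly α β g).natDegree = 1 := natDegree_linear h

theorem degree_comp_affinePoly {α β : G → k} {g : G} (h : α g ≠ 0) (p : k[X]) :
    (p.comp (affinePoly α β g)).degree = p.degree := by
  rcases eq_or_ne p 0 with rfl | hp
  · simp
  · have h1 : p.comp (affinePoly α β g) ≠ 0 := by
      intro h0
      rcases comp_eq_zero_iff.mp h0 with h0 | ⟨-, h0⟩
      · exact hp h0
      · have := congrArg natDegree h0
        rw [natDegree_affinePoly h, natDegree_C] at this
        exact one_ne_zero this
    rw [degree_eq_natDegree h1, degree_eq_natDegree hp, natDegree_comp, natDegree_affinePoly h,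
      mul_one]

/-- Affine substitutions preserve degrees, so uniqueness of Euclidean division passes
semi-invariance on to the quotient and the remainder. -/
theorem comp_mod_and_div_of_comp_eq {α β : G → k} {g : G} (h : α g ≠ 0) {u b : k[X]} {c d : k}
    (hu0 : u ≠ 0) (hu : u.comp (affinePoly α β g) = C c * u)
    (hb : b.comp (affinePoly α β g) = C d * b) :
    (b % u).comp (affinePoly α β g) = C d * (b % u) ∧
      C c * (b / u).comp (affinePoly α β g) = C d * (b / u) := by
  have h1 := EuclideanDomain.div_add_mod b u
  have h2 := congrArg (·.comp (affinePoly α β g)) h1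
  simp only [add_comp, mul_comp, hu, hb] at h2
  have h3 : u * (C c * (b / u).comp (affinePoly α β g) - C d * (b / u)) =
      C d * (b % u) - (b % u).comp (affinePoly α β g) := by
    linear_combination h2 - C d * h1
  have h4 : (C d * (b % u) - (b % u).comp (affinePoly α β g)).degree < u.degree := by
    refine (degree_sub_le _ _).trans_lt (max_lt ?_ ?_)
    · refine lt_of_le_of_lt ?_ (degree_mod_lt b hu0)
      rw [← smul_eq_C_mul]
      exact degree_smul_le _ _
    · rw [degree_comp_affinePoly h]
      exact degree_mod_lt b hu0
  rw [← h3, degree_mul] at h4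
  have h5 : C c * (b / u).comp (affinePoly α β g) - C d * (b / u) = 0 := by
    by_contra h6
    rw [degree_eq_natDegree hu0, degree_eq_natDegree h6, ← Nat.cast_add, Nat.cast_lt] at h4
    omega
  rw [h5, mul_zero] at h3
  exact ⟨(sub_eq_zero.mp h3.symm).symm, sub_eq_zero.mp h5⟩

variable [Group G] {α β : G → k}

namespace IsAffineAction

theorem α_ne_zero (hL : IsAffineAction α β) (g : G) : α g ≠ 0 := by
  intro h
  have h1 := hL.affine_mul g g⁻¹
  rw [mul_inv_cancel, hL.affine_one, affinePoly, affinePoly, h] at h1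
  have := congrArg natDegree h1
  simp [-map_mul, -map_add] at this

variable (hL : IsAffineAction α β)
include hL

/-- Take `u` of least degree: the remainder of `b` modulo `u` has the same character and smaller
degree, so it vanishes. -/
theorem exists_minimal_semiInvariant {χ : G → k} {s : k[X]} (hs0 : s ≠ 0)
    (hs : IsSemiInvariant α β χ s) :
    ∃ u : k[X], u ≠ 0 ∧ IsSemiInvariant α β χ u ∧
      (∀ b, IsSemiInvariant α β χ b → b ≠ 0 → u.natDegree ≤ b.natDegree) ∧
      ∀ b, IsSemiInvariant α β χ b → ∃ q, IsSemiInvariant α β (fun _ => 1) q ∧ b = u * q := by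
  classical
  have hex : ∃ n, ∃ u : k[X], u ≠ 0 ∧ IsSemiInvariant α β χ u ∧ u.natDegree = n :=
    ⟨_, s, hs0, hs, rfl⟩
  obtain ⟨u, hu0, hu, hn⟩ := Nat.find_spec hex
  have hmin : ∀ b, IsSemiInvariant α β χ b → b ≠ 0 → u.natDegree ≤ b.natDegree :=
    fun b hb hb0 => hn ▸ Nat.find_min' hex ⟨b, hb0, hb, rfl⟩
  refine ⟨u, hu0, hu, hmin, fun b hb => ?_⟩
  have hχ : ∀ g, χ g ≠ 0 := by
    intro g h
    have h1 := congrArg degree (hu g)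
    rw [degree_comp_affinePoly (hL.α_ne_zero g), h, map_zero, zero_mul, degree_zero,
      degree_eq_bot] at h1
    exact hu0 h1
  have h1 := fun g => comp_mod_and_div_of_comp_eq (hL.α_ne_zero g) hu0 (hu g) (hb g)
  have h2 : b % u = 0 := by
    by_contra h0
    have h3 := hmin _ (fun g => (h1 g).1) h0
    have h4 := degree_mod_lt b hu0
    exact absurd (natDegree_lt_natDegree h0 h4) (by omega)
  refine ⟨b / u, fun g => ?_, ?_⟩
  · rw [C_1, one_mul]
    exact mul_left_cancel₀ (C_ne_zero.mpr (hχ g)) (h1 g).2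
  · conv_lhs => rw [← EuclideanDomain.div_add_mod b u, h2, add_zero]

theorem prod_affinePoly_comp [Fintype G] (g : G) :
    (∏ h, affinePoly α β h).comp (affinePoly α β g) = ∏ h, affinePoly α β h := by
  rw [Polynomial.prod_comp]
  simp_rw [← hL.affine_mul]
  exact Fintype.prod_equiv (Equiv.mulLeft g) _ _ fun _ => rfl

theorem natDegree_prod_affinePoly [Fintype G] :
    (∏ h, affinePoly α β h).natDegree = Fintype.card G := by
  rw [Polynomial.natDegree_prod]
  · simp [natDegree_affinePoly (hL.α_ne_zero _)]
  · intro g _ h0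
    have := natDegree_affinePoly (β := β) (hL.α_ne_zero g)
    rw [h0] at this
    simp at this

/-- A generator of the ring of invariants. -/
theorem exists_generator_invariants [Finite G] : ∃ t : k[X], 0 < t.natDegree ∧
    IsSemiInvariant α β (fun _ => 1) t ∧
    (∀ p, IsSemiInvariant α β (fun _ => 1) p → 0 < p.natDegree → t.natDegree ≤ p.natDegree) ∧
    ∀ p, IsSemiInvariant α β (fun _ => 1) p → ∃ q : k[X], p = q.comp t := by
  classical
  have := Fintype.ofFinite G
  have hex : ∃ n, ∃ t : k[X], 0 < t.natDegree ∧ IsSemiInvariant α β (fun _ => 1) t ∧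
      t.natDegree = n :=
    ⟨_, ∏ h, affinePoly α β h, by rw [hL.natDegree_prod_affinePoly]; exact Fintype.card_pos,
      fun g => by rw [hL.prod_affinePoly_comp, C_1, one_mul], rfl⟩
  obtain ⟨t, ht0, ht, hn⟩ := Nat.find_spec hex
  have hmin : ∀ p, IsSemiInvariant α β (fun _ => 1) p → 0 < p.natDegree →
      t.natDegree ≤ p.natDegree := fun p hp hp0 => hn ▸ Nat.find_min' hex ⟨p, hp0, hp, rfl⟩
  refine ⟨t, ht0, ht, hmin, fun p => ?_⟩
  induction hd : p.natDegree using Nat.strong_induction_on generalizing p with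
  | _ n ih =>
    intro hp
    have ht1 : t ≠ 0 := by rintro rfl; simp at ht0
    have h1 := fun g => comp_mod_and_div_of_comp_eq (hL.α_ne_zero g) ht1 (ht g) (hp g)
    -- The remainder is invariant of degree below `deg t`, hence constant; the quotient is invariant
    -- of smaller degree, so induction applies to it.
    have h2 : (p % t).natDegree = 0 := by
      by_contra h0
      have h3 := hmin _ (fun g => (h1 g).1) (Nat.pos_of_ne_zero h0)
      have h4 := natDegree_mod_lt p ht0.ne'
      omega
    obtain ⟨c, hc⟩ := natDegree_eq_zero.mp h2
    have h5 := EuclideanDomain.div_add_mod p t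
    rcases Nat.eq_zero_or_pos n with h0 | h0
    · obtain ⟨c, rfl⟩ := natDegree_eq_zero.mp (hd.trans h0)
      exact ⟨C c, by simp⟩
    · have h6 : (p / t).natDegree < n := by
        rcases eq_or_ne (p / t) 0 with h | h
        · rwa [h, natDegree_zero]
        · have := congrArg natDegree h5
          rw [← hc, natDegree_add_C, natDegree_mul ht1 h] at this
          omega
      obtain ⟨q, hq⟩ := ih _ h6 (p / t) rfl
        (fun g => by simpa only [C_1, one_mul] using (h1 g).2)
      refine ⟨X * q + C c, ?_⟩
      rw [add_comp, mul_comp, X_comp, C_comp, ← hq, hc, h5]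

omit [Group G] hL in
-- Over `k[X]`, the polynomial `p(Z) - p(X)` in `Z` has the `|G|` distinct roots `Z = α(g)X + β(g)`.
theorem card_le_natDegree [Finite G] (hinj : Function.Injective (affinePoly α β)) {p : k[X]}
    (hp : IsSemiInvariant α β (fun _ => 1) p) (hp0 : 0 < p.natDegree) :
    Nat.card G ≤ p.natDegree := by
  classical
  have := Fintype.ofFinite G
  rw [Nat.card_eq_fintype_card]
  by_contra! h
  have h1 : p.map C - C p = 0 := by
    refine eq_zero_of_degree_lt_of_eval_finset_eq_zero (Finset.univ.image (affinePoly α β)) ?_ ?_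
    · rw [Finset.card_image_of_injective _ hinj, Finset.card_univ]
      refine degree_le_natDegree.trans_lt (Nat.cast_lt.mpr ?_)
      rw [natDegree_sub_C]
      exact natDegree_map_le.trans_lt h
    · intro x hx
      obtain ⟨g, -, rfl⟩ := Finset.mem_image.mp hx
      rw [eval_sub, eval_C, eval_map, ← comp, hp g, C_1, one_mul, sub_self]
  have h2 := congrArg natDegree (sub_eq_zero.mp h1)
  rw [natDegree_map_eq_of_injective C_injective, natDegree_C] at h2
  omega

omit hL in
-- Both sides have degree `|G|`, the same leading coefficient and the same `|G|` distinct roots.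
-- Specializing `X` to a point identifies the fibres of `t` with the orbits.
theorem sub_eq_prod [Fintype G] (hinj : Function.Injective (affinePoly α β)) {t : k[X]}
    (ht : IsSemiInvariant α β (fun _ => 1) t) (hdeg : t.natDegree = Nat.card G) :
    t.map C - C t = C (C t.leadingCoeff) * ∏ g, (X - C (affinePoly α β g)) := by
  classical
  have ht0 : t ≠ 0 := by
    rintro rfl
    exact Nat.card_pos.ne hdeg
  have hlc : (t.map C - C t).leadingCoeff = C t.leadingCoeff := by
    rw [leadingCoeff_sub_of_degree_lt, leadingCoeff_map_of_injective C_injective]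
    refine degree_C_le.trans_lt ?_
    rw [degree_map_eq_of_injective C_injective, ← natDegree_pos_iff_degree_pos, hdeg]
    exact Nat.card_pos
  have hmonic : (∏ g, (X - C (affinePoly α β g))).Monic := monic_prod_X_sub_C _ _
  have hlc0 : (C t.leadingCoeff : k[X]) ≠ 0 := C_ne_zero.mpr (leadingCoeff_ne_zero.mpr ht0)
  have hd1 : (t.map C - C t).natDegree = Fintype.card G := by
    rw [natDegree_sub_C, natDegree_map_eq_of_injective C_injective, hdeg, Nat.card_eq_fintype_card]
  refine eq_of_degree_le_of_eval_finset_eq (Finset.univ.image (affinePoly α β)) ?_ ?_ ?_ ?_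
  · rw [Finset.card_image_of_injective _ hinj, Finset.card_univ, ← hd1]
    exact degree_le_natDegree
  · rw [degree_C_mul hlc0, degree_eq_natDegree hmonic.ne_zero, natDegree_finsetProd_X_sub_C_eq_card,
      Finset.card_univ, ← hd1, degree_eq_natDegree]
    intro h0
    rw [h0, leadingCoeff_zero] at hlc
    exact hlc0 hlc.symm
  · rw [hlc, leadingCoeff_mul, leadingCoeff_C, hmonic.leadingCoeff, mul_one]
  · intro x hx
    obtain ⟨g, -, rfl⟩ := Finset.mem_image.mp hx
    rw [eval_sub, eval_C, eval_map, ← comp, ht g, C_1, one_mul, sub_self, eval_mul, eval_prod,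
      Finset.prod_eq_zero (Finset.mem_univ g) (by simp), mul_zero]

/-- By Dedekind's independence of characters, applied to the distinct substitution maps, the twisted
trace `∑ χ(g)⁻¹ p(α(g)X + β(g))` is nonzero for some `p`. -/
theorem exists_semiInvariant [Finite G] (hinj : Function.Injective (affinePoly α β)) (χ : G →* kˣ) :
    ∃ s : k[X], s ≠ 0 ∧ IsSemiInvariant α β (fun g => χ g) s := by
  classical
  have := Fintype.ofFinite G
  let φ : G → (k[X] →* k[X]) := fun g => (compRingHom (affinePoly α β g) : k[X] →* k[X])
  have hφ : Function.Injective φ := by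
    intro g h hgh
    apply hinj
    have := DFunLike.congr_fun hgh X
    simpa [φ] using this
  have hli := (linearIndependent_monoidHom k[X] k[X]).comp φ hφ
  rw [Fintype.linearIndependent_iff] at hli
  have hex : ∃ p : k[X], ∑ g, C ((χ g)⁻¹ : k) * p.comp (affinePoly α β g) ≠ 0 := by
    by_contra! h0
    have := hli (fun g => C ((χ g)⁻¹ : k)) (by
      ext1 p
      simpa [φ] using h0 p) 1
    simp at this
  obtain ⟨p, hp⟩ := hex
  refine ⟨_, hp, fun g => ?_⟩
  rw [Polynomial.sum_comp, Finset.mul_sum]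
  refine Fintype.sum_equiv (Equiv.mulLeft g) _ _ fun h => ?_
  rw [mul_comp, C_comp, comp_assoc, ← hL.affine_mul, ← mul_assoc, ← C_mul]
  congr 2
  rw [Equiv.coe_mulLeft, MonoidHom.map_mul, Units.val_mul, mul_inv,
    mul_inv_cancel_left₀ (χ g).ne_zero]

end IsAffineAction

end SemiInvariants

/-! ### Orbits with nontrivial stabilizer. -/

open MulAction in
/-- If every nontrivial element of a finite group has at most one fixed point, then the points with
nontrivial stabilizer form at most one orbit. -/
theorem mem_orbit_of_smul_eq {G X : Type*} [Group G] [Finite G] [MulAction G X]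
    (hfix : ∀ g : G, g ≠ 1 → ∀ x y : X, g • x = x → g • y = y → x = y) {a b : X} {g h : G}
    (hg : g ≠ 1) (hga : g • a = a) (hh : h ≠ 1) (hhb : h • b = b) : b ∈ orbit G a := by
  classical
  have := Fintype.ofFinite G
  let S : X → Finset G := fun a => Finset.univ.filter fun g => g ≠ 1 ∧ ∃ x ∈ orbit G a, g • x = x
  -- The stabilizers along the orbit, with `1` removed, are disjoint, so `S a` has at least `|orbit|
  -- (|stab| - 1) = |G| - |orbit|` elements. This is at least `|G|/2` because `|stab| ≥ 2`.
  have hS : ∀ (a : X) (g : G), g ≠ 1 → g • a = a → Fintype.card G ≤ 2 * (S a).card := by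
    intro a g hg hga
    have : Finite (orbit G a) := Set.finite_range _
    have hfo : Fintype (orbit G a) := Fintype.ofFinite _
    let T : X → Finset G := fun x => (Finset.univ.filter fun g => g • x = x).erase 1
    have hT : ∀ x, (T x).card = Fintype.card (stabilizer G x) - 1 := by
      intro x
      rw [Finset.card_erase_of_mem (by simp), Fintype.card_subtype]
      rfl
    have hst : ∀ x ∈ orbit G a, Fintype.card (orbit G a) * Fintype.card (stabilizer G x) =
        Fintype.card G := by
      intro x hx
      have : Finite (orbit G x) := Set.finite_range _
      have hfx : Fintype (orbit G x) := Fintype.ofFinite _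
      rw [← card_orbit_mul_card_stabilizer_eq_card_group G x]
      congr 1
      exact Fintype.card_congr (Equiv.setCongr (orbit_eq_iff.mpr hx).symm)
    have hsub : (orbit G a).toFinset.biUnion T ⊆ S a := by
      intro y hy
      simp only [Finset.mem_biUnion, Set.mem_toFinset, T, Finset.mem_erase, Finset.mem_filter,
        Finset.mem_univ, true_and] at hy
      obtain ⟨x, hx, hy1, hyx⟩ := hy
      simp only [S, Finset.mem_filter, Finset.mem_univ, true_and]
      exact ⟨hy1, x, hx, hyx⟩
    have hcard := Finset.card_le_card hsub
    rw [Finset.card_biUnion] at hcard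
    · have h2 : 1 < Fintype.card (stabilizer G a) := by
        rw [Fintype.one_lt_card_iff]
        exact ⟨1, ⟨g, hga⟩, fun h => hg (Subtype.ext_iff.mp h).symm⟩
      have h1 := hst a (mem_orbit_self a)
      have ho : 0 < Fintype.card (orbit G a) := Fintype.card_pos_iff.mpr ⟨⟨a, mem_orbit_self a⟩⟩
      have h3 : ∀ x ∈ (orbit G a).toFinset, (T x).card = Fintype.card (stabilizer G a) - 1 := by
        intro x hx
        rw [hT]
        congr 1
        exact Nat.eq_of_mul_eq_mul_left ho ((hst x (Set.mem_toFinset.mp hx)).trans h1.symm)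
      rw [Finset.sum_congr rfl h3, Finset.sum_const, smul_eq_mul, Set.toFinset_card] at hcard
      obtain ⟨m, hm⟩ := Nat.exists_eq_add_of_le h2
      rw [hm] at h1 hcard
      rw [← h1]
      simp only [Nat.succ_eq_add_one] at hcard
      rw [show 0 + 1 + 1 + m - 1 = m + 1 by omega] at hcard
      nlinarith
    · intro x _ y _ hxy
      rw [Function.onFun, Finset.disjoint_left]
      intro z hz hz'
      simp only [T, Finset.mem_erase, Finset.mem_filter, Finset.mem_univ, true_and] at hz hz'
      exact hxy (hfix z hz.1 x y hz.2 hz'.2)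
  by_contra hab
  -- Distinct orbits would give two disjoint sets, each at least half of `G`, both missing `1`.
  have hdisj : Disjoint (S a) (S b) := by
    rw [Finset.disjoint_left]
    intro z hz hz'
    simp only [S, Finset.mem_filter, Finset.mem_univ, true_and] at hz hz'
    obtain ⟨hz1, x, hx, hzx⟩ := hz
    obtain ⟨-, y, hy, hzy⟩ := hz'
    obtain rfl := hfix z hz1 x y hzx hzy
    exact hab (orbit_eq_iff.mp ((orbit_eq_iff.mpr hy).symm.trans (orbit_eq_iff.mpr hx)))
  have hlt : (S a ∪ S b).card < Fintype.card G := by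
    rw [← Finset.card_univ]
    refine Finset.card_lt_card (Finset.ssubset_univ_iff.mpr fun h => ?_)
    have : (1 : G) ∈ S a ∪ S b := h ▸ Finset.mem_univ _
    simp [S] at this
  rw [Finset.card_union_of_disjoint hdisj] at hlt
  have := hS a g hg hga
  have := hS b h hh hhb
  omega

theorem ncard_rootSet_of_separable {k : Type*} [Field k] {p : k[X]} (hp : p.Separable) :
    (p.rootSet (AlgebraicClosure k)).ncard = p.natDegree := by
  rw [← Nat.card_coe_set_eq, Nat.card_eq_fintype_card]
  exact card_rootSet_eq_natDegree hp (IsAlgClosed.splits _)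

/-! ### The action on points over the algebraic closure. -/

section Points

variable {k : Type*} [Field k] {G : Type*} {α β : G → k}

local notation "K" => AlgebraicClosure k

theorem aeval_affinePoly (g : G) (a : K) : aeval a (affinePoly α β g) = affineAct α β g a := by
  simp [affinePoly, affineAct]

theorem IsSemiInvariant.aeval_affineAct {χ : G → k} {p : k[X]} (hp : IsSemiInvariant α β χ p)
    (g : G) (a : K) :
    aeval (affineAct α β g a) p = algebraMap k K (χ g) * aeval a p := by
  rw [← aeval_affinePoly, ← aeval_comp, hp g, map_mul, aeval_C]

theorem IsSemiInvariant.aeval_affineAct_eq_zero {χ : G → k} {p : k[X]}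
    (hp : IsSemiInvariant α β χ p) (g : G) {a : K} (ha : aeval a p = 0) :
    aeval (affineAct α β g a) p = 0 := by
  rw [hp.aeval_affineAct, ha, mul_zero]

variable [Group G]

namespace IsAffineAction

variable (hL : IsAffineAction α β)
include hL

theorem affineAct_one (a : K) : affineAct α β 1 a = a := by
  rw [← aeval_affinePoly, hL.affine_one, aeval_X]

/-- Substitutions act contravariantly on points, so this is a right action; `mulAction` compensates
with an inverse. -/
theorem affineAct_mul (g h : G) (a : K) :
    affineAct α β (g * h) a = affineAct α β h (affineAct α β g a) := by
  rw [← aeval_affinePoly, hL.affine_mul, aeval_comp, aeval_affinePoly, aeval_affinePoly]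

/-- The left action of `G` on the affine line. -/
abbrev mulAction : MulAction G K where
  smul g a := affineAct α β g⁻¹ a
  one_smul a := by
    change affineAct α β 1⁻¹ a = a
    rw [inv_one, hL.affineAct_one]
  mul_smul g h a := by
    change affineAct α β (g * h)⁻¹ a = affineAct α β g⁻¹ (affineAct α β h⁻¹ a)
    rw [mul_inv_rev, hL.affineAct_mul]

variable (hinj : Function.Injective (affinePoly α β))

include hinj in
-- An affine map with two fixed points is the identity, and the action is faithful.
theorem eq_of_affineAct_eq {g : G} (hg : g ≠ 1) {a b : K} (ha : affineAct α β g a = a)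
    (hb : affineAct α β g b = b) : a = b := by
  by_contra hab
  unfold affineAct at ha hb
  have h1 : (algebraMap k K (α g) - 1) * (a - b) = 0 := by linear_combination ha - hb
  have h2 : algebraMap k K (α g) = 1 :=
    sub_eq_zero.mp ((mul_eq_zero.mp h1).resolve_right (sub_ne_zero.mpr hab))
  rw [h2, one_mul, add_eq_left, map_eq_zero] at ha
  rw [map_eq_one_iff _ (algebraMap k K).injective] at h2
  apply hg
  apply hinj
  rw [hL.affine_one, affinePoly, h2, ha, map_one, one_mul, map_zero, add_zero]

theorem eq_one_of_affineAct_affineAct_eq {a : K} (ha : ∀ g : G, affineAct α β g a = a → g = 1)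
    {g h : G} (hgh : affineAct α β h (affineAct α β g a) = affineAct α β g a) : h = 1 := by
  have h1 : affineAct α β (g * h * g⁻¹) a = a := by
    rw [hL.affineAct_mul, hL.affineAct_mul, hgh, ← hL.affineAct_mul, mul_inv_cancel,
      hL.affineAct_one]
  simpa using ha _ h1

theorem affineAct_injective {a : K} (ha : ∀ g : G, affineAct α β g a = a → g = 1) :
    Function.Injective fun g => affineAct α β g a := by
  intro g h hgh
  have h1 : affineAct α β (g * h⁻¹) a = a := by
    rw [hL.affineAct_mul]
    change affineAct α β g a = affineAct α β h a at hgh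
    rw [hgh, ← hL.affineAct_mul, mul_inv_cancel, hL.affineAct_one]
  exact mul_inv_eq_one.mp (ha _ h1)

variable [Finite G]

include hinj in
/-- The points with nontrivial stabilizer form at most one orbit. -/
theorem exists_affineAct_eq {a b : K} {g h : G} (hg : g ≠ 1) (ha : affineAct α β g a = a)
    (hh : h ≠ 1) (hb : affineAct α β h b = b) : ∃ g, affineAct α β g a = b := by
  let := hL.mulAction
  obtain ⟨x, hx⟩ := mem_orbit_of_smul_eq (G := G) (X := K) (g := g⁻¹) (h := h⁻¹)
    (fun g hg x y hx hy => hL.eq_of_affineAct_eq hinj (inv_ne_one.mpr hg) hx hy)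
    (inv_ne_one.mpr hg)
    (by change affineAct α β g⁻¹⁻¹ a = a; rwa [inv_inv]) (inv_ne_one.mpr hh)
    (by change affineAct α β h⁻¹⁻¹ b = b; rwa [inv_inv])
  exact ⟨x⁻¹, hx⟩

variable {t : k[X]} (ht : IsSemiInvariant α β (fun _ => 1) t) (htdeg : t.natDegree = Nat.card G)

omit hL [Finite G] in
include hinj ht htdeg in
theorem map_sub_C_eq_prod [Fintype G] (a : K) :
    t.map (algebraMap k K) - C (aeval a t) =
      C (algebraMap k K t.leadingCoeff) * ∏ g, (X - C (affineAct α β g a)) := by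
  have h := congrArg (Polynomial.map ((aeval a : k[X] →ₐ[k] K) : k[X] →+* K))
    (sub_eq_prod hinj ht htdeg)
  rw [Polynomial.map_sub, Polynomial.map_map, Polynomial.map_mul, Polynomial.map_prod] at h
  have h1 : ((aeval a : k[X] →ₐ[k] K) : k[X] →+* K).comp C = algebraMap k K := by
    ext; simp
  simpa [h1, aeval_affinePoly] using h

omit hL in
include hinj ht htdeg in
theorem exists_affineAct_eq_of_aeval_eq {a b : K} (hab : aeval a t = aeval b t) :
    ∃ g, affineAct α β g a = b := by
  have := Fintype.ofFinite G
  have h := congrArg (eval b) (map_sub_C_eq_prod hinj ht htdeg a)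
  rw [eval_sub, eval_map_algebraMap, eval_C, hab, sub_self, eval_mul, eval_C, eval_prod] at h
  have hlc : algebraMap k K t.leadingCoeff ≠ 0 := by
    rw [Ne, map_eq_zero, leadingCoeff_eq_zero]
    rintro rfl
    exact Nat.card_pos.ne htdeg
  obtain ⟨g, -, hg⟩ := Finset.prod_eq_zero_iff.mp ((mul_eq_zero.mp h.symm).resolve_left hlc)
  refine ⟨g, ?_⟩
  simpa [sub_eq_zero, eq_comm] using hg

include hinj ht htdeg in
-- The factors of `1` and of `h` in the product over `G` both equal `X - a`: `t` ramifies at `a`.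
theorem sq_dvd_map_sub_C {a : K} {h : G} (hh : h ≠ 1) (ha : affineAct α β h a = a) :
    (X - C a) ^ 2 ∣ t.map (algebraMap k K) - C (aeval a t) := by
  classical
  have := Fintype.ofFinite G
  rw [map_sub_C_eq_prod hinj ht htdeg a]
  apply Dvd.dvd.mul_left
  have h1 := Finset.prod_dvd_prod_of_subset {1, h} Finset.univ
    (fun g => X - C (affineAct α β g a)) (Finset.subset_univ _)
  rwa [Finset.prod_pair hh.symm, ha, hL.affineAct_one, ← sq] at h1

/-! ### Roots of `P` and regular orbits on the roots of `f`. -/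

section Counting

variable {f u P : k[X]} {χ ψ : G → k} (hf : f.Separable) (hfψ : IsSemiInvariant α β ψ f)
  (hu0 : u ≠ 0) (hu : IsSemiInvariant α β χ u) (hudeg : u.natDegree < Nat.card G)
  (hP : P.comp t = u ^ 2 * f)

omit hL [Group G] [Finite G] in
include hu0 hf htdeg hP in
theorem natDegree_mul_card : P.natDegree * Nat.card G = 2 * u.natDegree + f.natDegree := by
  have h := congrArg natDegree hP
  rwa [natDegree_comp, natDegree_mul (pow_ne_zero 2 hu0) hf.ne_zero, natDegree_pow, htdeg] at h

omit hL [Group G] [Finite G] in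
include hf hu0 hudeg hP htdeg in
-- If `q² ∣ P` then `q(t)² ∣ u² f`, so `q(t) ∣ u` by squarefreeness of `f`; since `deg u < |G| = deg
-- t`, `q` is constant. Working over the algebraic closure makes squarefree and separable
-- equivalent.
theorem separable_of_comp_eq : P.Separable := by
  have hN : 0 < t.natDegree := by omega
  rw [← separable_map (algebraMap k K), ← PerfectField.separable_iff_squarefree.symm]
  intro q hq
  obtain ⟨s, hs⟩ := hq
  have h1 := congrArg (Polynomial.map (algebraMap k K)) hP
  rw [map_comp, hs, mul_comp, mul_comp, Polynomial.map_mul, Polynomial.map_pow, ← sq] at h1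
  have h2 := dvd_of_sq_dvd_sq_mul_of_squarefree (hf.map (f := algebraMap k K)).squarefree ⟨_, h1.symm⟩
  have h3 := natDegree_le_of_dvd h2 (Polynomial.map_ne_zero hu0)
  rw [natDegree_comp, natDegree_map, natDegree_map, htdeg] at h3
  have h4 : q.natDegree = 0 := by
    by_contra h
    have := Nat.le_mul_of_pos_left (Nat.card G) (Nat.pos_of_ne_zero h)
    omega
  obtain ⟨c, rfl⟩ := natDegree_eq_zero.mp h4
  rw [isUnit_C, isUnit_iff_ne_zero]
  rintro rfl
  rw [map_zero, zero_comp, zero_dvd_iff] at h2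
  exact Polynomial.map_ne_zero hu0 h2

include hu hu0 hudeg in
-- A zero would spread over an orbit of `|G| > deg u` points.
theorem aeval_ne_zero_of_regular {a : K} (ha : ∀ g : G, affineAct α β g a = a → g = 1) :
    aeval a u ≠ 0 := by
  classical
  have := Fintype.ofFinite G
  intro h0
  have hinj' := hL.affineAct_injective ha
  apply (Polynomial.map_ne_zero (f := algebraMap k K) hu0)
  refine eq_zero_of_degree_lt_of_eval_finset_eq_zero
    (Finset.univ.image fun g => affineAct α β g a) ?_ ?_
  · rw [Finset.card_image_of_injective _ hinj', Finset.card_univ, ← Nat.card_eq_fintype_card]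
    refine degree_le_natDegree.trans_lt (Nat.cast_lt.mpr ?_)
    rwa [natDegree_map]
  · intro x hx
    obtain ⟨g, -, rfl⟩ := Finset.mem_image.mp hx
    rw [eval_map_algebraMap]
    exact hu.aeval_affineAct_eq_zero g h0

/-- The roots of `f` on which `G` acts freely. -/
def regularRoots (α β : G → k) (f : k[X]) : Set K :=
  {a | a ∈ f.rootSet K ∧ ∀ g : G, affineAct α β g a = a → g = 1}

omit [Finite G] in
theorem regularOrbits_eq_image : regularOrbits α β (f.rootSet K) =
    (fun a => Set.range fun g => affineAct α β g a) '' regularRoots α β f := by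
  ext O
  constructor
  · rintro ⟨⟨a, ha, rfl⟩, hreg⟩
    exact ⟨a, ⟨ha, hreg a ⟨1, hL.affineAct_one a⟩⟩, rfl⟩
  · rintro ⟨a, ⟨ha, hreg⟩, rfl⟩
    refine ⟨⟨a, ha, rfl⟩, ?_⟩
    rintro _ ⟨g, rfl⟩ h hh
    exact hL.eq_one_of_affineAct_affineAct_eq hreg hh

include ht htdeg hinj in
-- Orbits are the fibres of `t`, so they can be counted by the values of `t`.
theorem ncard_regularOrbits : (regularOrbits α β (f.rootSet K)).ncard =
    ((fun a => aeval a t) '' regularRoots α β f).ncard := by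
  have h1 : ∀ a : K, (fun x => aeval x t) ⁻¹' {aeval a t} =
      Set.range fun g => affineAct α β g a := by
    intro a
    ext b
    constructor
    · intro hb
      exact exists_affineAct_eq_of_aeval_eq hinj ht htdeg (Eq.symm hb)
    · rintro ⟨g, rfl⟩
      simp [ht.aeval_affineAct]
  rw [hL.regularOrbits_eq_image]
  simp_rw [← h1]
  rw [← Set.image_image (fun c => (fun x : K => aeval x t) ⁻¹' {c}) (fun a => aeval a t)]
  refine Set.InjOn.ncard_image ?_
  rintro _ ⟨a, -, rfl⟩ _ ⟨b, -, rfl⟩ hab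
  have : a ∈ (fun x : K => aeval x t) ⁻¹' {aeval b t} := by
    rw [← show _ = (fun x : K => aeval x t) ⁻¹' {aeval b t} from hab]
    rfl
  exact this

include hf hfψ ht htdeg hinj in
-- Each value of `t` on a regular root is taken at `|G|` distinct regular roots.
theorem card_mul_ncard_regularOrbits_le :
    Nat.card G * (regularOrbits α β (f.rootSet K)).ncard ≤ f.natDegree := by
  classical
  have := Fintype.ofFinite G
  have hfin : (regularRoots α β f).Finite := (f.rootSet_finite K).subset fun a ha => ha.1
  rw [hL.ncard_regularOrbits hinj ht htdeg]
  have h1 : (fun a => aeval a t) '' regularRoots α β f =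
      (hfin.toFinset.image fun a => aeval a t : Finset K) := by simp
  rw [h1, Set.ncard_coe_finset]
  refine (Finset.mul_card_image_le_card (f := fun a : K => aeval a t) hfin.toFinset (Nat.card G)
    ?_).trans ?_
  · intro c hc
    obtain ⟨a, ha, rfl⟩ := Finset.mem_image.mp hc
    rw [Set.Finite.mem_toFinset] at ha
    rw [Nat.card_eq_fintype_card, ← Finset.card_univ,
      ← Finset.card_image_of_injective _ (hL.affineAct_injective ha.2)]
    refine Finset.card_le_card fun x hx => ?_
    obtain ⟨g, -, rfl⟩ := Finset.mem_image.mp hx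
    rw [Finset.mem_filter, Set.Finite.mem_toFinset]
    refine ⟨⟨?_, fun h => hL.eq_one_of_affineAct_affineAct_eq ha.2⟩, by simp [ht.aeval_affineAct]⟩
    rw [mem_rootSet_of_ne hf.ne_zero]
    exact hfψ.aeval_affineAct_eq_zero g ((mem_rootSet_of_ne hf.ne_zero).mp ha.1)
  · rw [← Set.ncard_eq_toFinset_card _ hfin, ← ncard_rootSet_of_separable hf]
    exact Set.ncard_le_ncard (fun a ha => ha.1) (f.rootSet_finite K)

omit hL [Finite G] in
include hf htdeg hu0 hudeg hP in
theorem image_regularRoots_subset :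
    (fun a => aeval a t) '' regularRoots α β f ⊆ P.rootSet K := by
  have hP0 := (separable_of_comp_eq htdeg hf hu0 hudeg hP).ne_zero
  rintro _ ⟨a, ha, rfl⟩
  rw [mem_rootSet_of_ne hP0, ← aeval_comp, hP, map_mul,
    (mem_rootSet_of_ne hf.ne_zero).mp ha.1, mul_zero]

include hf htdeg hu0 hu hudeg hP in
/-- The roots of `P` outside the image of the regular roots of `f` lie below points with
nontrivial stabilizer. -/
theorem exists_affineAct_eq_of_notMem {c : K} (hc : c ∈ P.rootSet K)
    (hc' : c ∉ (fun a => aeval a t) '' regularRoots α β f) :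
    ∃ a : K, aeval a t = c ∧ (aeval a u = 0 ∨ aeval a f = 0) ∧
      ∃ h : G, h ≠ 1 ∧ affineAct α β h a = a := by
  have hP0 := (separable_of_comp_eq htdeg hf hu0 hudeg hP).ne_zero
  obtain ⟨a, ha⟩ := IsAlgClosed.exists_root (t.map (algebraMap k K) - C c) (fun h => by
    have := natDegree_eq_of_degree_eq_some h
    rw [natDegree_sub_C, natDegree_map, htdeg] at this
    exact Nat.card_pos.ne' this)
  rw [IsRoot, eval_sub, eval_C, eval_map_algebraMap, sub_eq_zero] at ha
  subst ha
  have h1 : aeval a u = 0 ∨ aeval a f = 0 := by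
    have := (mem_rootSet_of_ne hP0).mp hc
    rw [← aeval_comp, hP, map_mul, map_pow] at this
    simpa using this
  refine ⟨a, rfl, h1, ?_⟩
  by_contra! hreg
  have hreg' : ∀ g : G, affineAct α β g a = a → g = 1 := fun g hg => by
    by_contra h
    exact hreg g h hg
  exact hc' ⟨a, ⟨(mem_rootSet_of_ne hf.ne_zero).mpr
    (h1.resolve_left (hL.aeval_ne_zero_of_regular hu0 hu hudeg hreg')), hreg'⟩, rfl⟩

include hf ht htdeg hinj hu0 hu hudeg hP in
-- A root of `P` below a point `a` with nontrivial stabilizer would make `(X - a)²` divide `t -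
-- t(a)`, hence `f`, since `u` is constant.
theorem ncard_regularOrbits_of_natDegree_eq_zero (hu1 : u.natDegree = 0) :
    (regularOrbits α β (f.rootSet K)).ncard = P.natDegree := by
  rw [hL.ncard_regularOrbits hinj ht htdeg,
    ← ncard_rootSet_of_separable (separable_of_comp_eq htdeg hf hu0 hudeg hP)]
  congr 1
  refine (image_regularRoots_subset htdeg hf hu0 hudeg hP).antisymm fun c hc => ?_
  by_contra hc'
  obtain ⟨a, rfl, -, h, hh, ha⟩ :=
    hL.exists_affineAct_eq_of_notMem htdeg hf hu0 hu hudeg hP hc hc'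
  obtain ⟨e, rfl⟩ := natDegree_eq_zero.mp hu1
  have hP0 := (separable_of_comp_eq htdeg hf hu0 hudeg hP).ne_zero
  have h1 : (X - C (aeval a t)) ∣ P.map (algebraMap k K) := by
    rw [dvd_iff_isRoot, IsRoot, eval_map_algebraMap]
    exact (mem_rootSet_of_ne hP0).mp hc
  obtain ⟨s, hs⟩ := h1
  have h2 := congrArg (Polynomial.map (algebraMap k K)) hP
  rw [map_comp, hs, mul_comp, sub_comp, X_comp, C_comp, Polynomial.map_mul, ← C_pow, map_C] at h2
  have he : algebraMap k K (e ^ 2) ≠ 0 := by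
    rw [Ne, map_eq_zero]
    exact pow_ne_zero 2 (C_ne_zero.mp hu0)
  have h3 : (X - C a) ^ 2 ∣ f.map (algebraMap k K) :=
    (isUnit_C.mpr (isUnit_iff_ne_zero.mpr he)).dvd_mul_left.mp
      (h2 ▸ (hL.sq_dvd_map_sub_C hinj ht htdeg hh ha).mul_right _)
  rw [sq] at h3
  exact not_isUnit_X_sub_C _ ((hf.map (f := algebraMap k K)).squarefree _ h3)

include hf ht htdeg hinj hu0 hu hudeg hP in
-- A root of `u` is not a regular point, so it lies above a root of `P` not coming from a regular
-- orbit. There is only one such root because the non-regular points form a single orbit.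
theorem ncard_regularOrbits_add_one (hu1 : u.natDegree ≠ 0) :
    (regularOrbits α β (f.rootSet K)).ncard + 1 = P.natDegree := by
  have hP0 := (separable_of_comp_eq htdeg hf hu0 hudeg hP).ne_zero
  rw [hL.ncard_regularOrbits hinj ht htdeg,
    ← ncard_rootSet_of_separable (separable_of_comp_eq htdeg hf hu0 hudeg hP)]
  have hsub := image_regularRoots_subset (α := α) (β := β) htdeg hf hu0 hudeg hP
  obtain ⟨a, ha⟩ := IsAlgClosed.exists_aeval_eq_zero K u (fun h => hu1 (natDegree_eq_of_degree_eq_some h))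
  have h1 : aeval a t ∉ (fun a => aeval a t) '' regularRoots α β f := by
    rintro ⟨b, hb, hba⟩
    obtain ⟨g, rfl⟩ := exists_affineAct_eq_of_aeval_eq hinj ht htdeg (Eq.symm hba)
    exact hL.aeval_ne_zero_of_regular hu0 hu hudeg hb.2 (hu.aeval_affineAct_eq_zero g ha)
  have h2 : aeval a t ∈ P.rootSet K := by
    rw [mem_rootSet_of_ne hP0, ← aeval_comp, hP, map_mul, map_pow, ha]
    simp
  have h3 : P.rootSet K = insert (aeval a t) ((fun a => aeval a t) '' regularRoots α β f) := by
    refine Set.Subset.antisymm (fun c hc => ?_) (Set.insert_subset h2 hsub)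
    by_cases hc' : c ∈ (fun a => aeval a t) '' regularRoots α β f
    · exact .inr hc'
    left
    obtain ⟨b, rfl, -, h, hh, hb⟩ :=
      hL.exists_affineAct_eq_of_notMem htdeg hf hu0 hu hudeg hP hc hc'
    obtain ⟨a', ha', -, h', hh', hb'⟩ :=
      hL.exists_affineAct_eq_of_notMem htdeg hf hu0 hu hudeg hP h2 h1
    obtain ⟨g, rfl⟩ := hL.exists_affineAct_eq hinj hh hb hh' hb'
    rw [← ha', ht.aeval_affineAct, map_one, one_mul]
  rw [h3, Set.ncard_insert_of_notMem h1 ((P.rootSet_finite K).subset hsub)]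

end Counting

end IsAffineAction

end Points

/-! ### The function field of the quotient curve. -/

namespace HyperellipticCurve

variable {k : Type*} [Field k] (C : HyperellipticCurve k)

theorem algEquiv_ext {σ τ : C.FunctionField ≃ₐ[k] C.FunctionField}
    (hx : σ C.xCoord = τ C.xCoord) (hy : σ C.yCoord = τ C.yCoord) : σ = τ := by
  have haeval : ∀ p : k[X], σ (aeval C.xCoord p) = τ (aeval C.xCoord p) := fun p => by
    rw [← AlgEquiv.coe_toAlgHom σ, ← aeval_algHom_apply, ← AlgEquiv.coe_toAlgHom τ,
      ← aeval_algHom_apply, AlgEquiv.coe_toAlgHom, AlgEquiv.coe_toAlgHom, hx]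
  ext z
  obtain ⟨p, q, c, hc, h⟩ := C.exists_mul_aeval_eq C.FunctionField z
  change z * aeval C.xCoord c = aeval C.xCoord p + aeval C.xCoord q * C.yCoord at h
  have hc' : aeval C.xCoord c ≠ 0 := fun h0 =>
    hc (transcendental_iff.mp (C.xIn_transcendental C.FunctionField) c h0)
  rw [← eq_div_iff hc'] at h
  rw [h]
  simp only [map_div₀, map_add, map_mul, haeval, hy]

theorem aeval_xCoord_injective : Function.Injective (aeval (R := k) C.xCoord) :=
  transcendental_iff_injective.mp (C.xIn_transcendental C.FunctionField)

section AffineGroup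

variable {C} {G : Subgroup (C.FunctionField ≃ₐ[k] C.FunctionField)} {α β γ : G → k}
  (hX : ∀ g : G, (g : C.FunctionField ≃ₐ[k] C.FunctionField) C.xCoord =
    algebraMap k C.FunctionField (α g) * C.xCoord + algebraMap k C.FunctionField (β g))
  (hY : ∀ g : G, (g : C.FunctionField ≃ₐ[k] C.FunctionField) C.yCoord =
    algebraMap k C.FunctionField (γ g) * C.yCoord)

include hX in
theorem apply_aeval_xCoord (g : G) (p : k[X]) :
    (g : C.FunctionField ≃ₐ[k] C.FunctionField) (aeval C.xCoord p) =
      aeval C.xCoord (p.comp (affinePoly α β g)) := by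
  rw [← AlgEquiv.coe_toAlgHom, ← aeval_algHom_apply, AlgEquiv.coe_toAlgHom, hX, aeval_comp]
  congr 2
  simp [affinePoly]

include hX in
theorem isAffineAction : IsAffineAction α β where
  affine_one := by
    apply C.aeval_xCoord_injective
    have := apply_aeval_xCoord hX 1 X
    rw [X_comp] at this
    rw [← this, OneMemClass.coe_one, AlgEquiv.one_apply]
  affine_mul g h := by
    apply C.aeval_xCoord_injective
    have h1 := apply_aeval_xCoord hX (g * h) X
    have h2 := apply_aeval_xCoord hX h X
    have h3 := apply_aeval_xCoord hX g (affinePoly α β h)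
    rw [X_comp] at h1 h2
    rw [← h1, ← h3, ← h2, Subgroup.coe_mul, AlgEquiv.mul_apply]

theorem yCoord_ne_zero : C.yCoord ≠ 0 := C.yIn_ne_zero C.FunctionField

/-- The action on the coordinate `Y` as a character. -/
def yCharacter : G →* kˣ := MonoidHom.toHomUnits
  { toFun := γ
    map_one' := by
      have h := hY 1
      rw [OneMemClass.coe_one, AlgEquiv.one_apply, eq_comm, mul_eq_right₀ yCoord_ne_zero] at h
      exact (map_eq_one_iff _ (algebraMap k C.FunctionField).injective).mp h
    map_mul' := fun g h => by
      have h1 := hY (g * h)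
      rw [Subgroup.coe_mul, AlgEquiv.mul_apply, hY, map_mul, hY, AlgEquiv.commutes, ← mul_assoc,
        ← map_mul] at h1
      have h2 := (algebraMap k C.FunctionField).injective (mul_right_cancel₀ yCoord_ne_zero h1)
      rw [← h2, mul_comm] }

include hY in
theorem yCharacter_ne_zero (g : G) : γ g ≠ 0 := (yCharacter hY g).ne_zero

theorem coe_inv_yCharacter (g : G) : (((yCharacter hY)⁻¹ g : kˣ) : k) = (γ g)⁻¹ :=
  Units.val_inv_eq_inv_val _

include hX hY in
theorem isSemiInvariant_f : IsSemiInvariant α β (fun g => γ g ^ 2) C.f := by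
  intro g
  apply C.aeval_xCoord_injective
  have hy : C.yCoord ^ 2 = aeval C.xCoord C.f := C.yIn_sq C.FunctionField
  rw [← apply_aeval_xCoord hX, ← hy, map_pow, hY, map_mul, ← hy, aeval_C, map_pow, mul_pow]

include hX hY in
-- An element fixing `X` fixes `f = Y²`, so it sends `Y` to `±Y` and is `1` or `ι`.
theorem affinePoly_injective (hι : C.involution ∉ G) :
    Function.Injective (affinePoly α β) := by
  have hL := isAffineAction hX
  have key : ∀ g : G, affinePoly α β g = X → g = 1 := by
    intro g hg
    have hx : (g : C.FunctionField ≃ₐ[k] C.FunctionField) C.xCoord = C.xCoord := by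
      have := apply_aeval_xCoord hX g X
      rwa [X_comp, hg, aeval_X] at this
    have hγ : γ g ^ 2 = 1 := by
      have h := isSemiInvariant_f hX hY g
      rw [hg, comp_X, eq_comm, mul_eq_right₀ C.separable.ne_zero] at h
      exact C_injective (h.trans C_1.symm)
    rcases (mul_self_eq_one_iff.mp ((sq _).symm.trans hγ)) with h | h
    · apply Subtype.ext
      refine C.algEquiv_ext hx ?_
      rw [hY, h, map_one, one_mul, OneMemClass.coe_one, AlgEquiv.one_apply]
    · refine absurd g.2 ?_
      rw [show (g : C.FunctionField ≃ₐ[k] C.FunctionField) = C.involution from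
        C.algEquiv_ext (hx.trans C.involution_xCoord.symm) (by
          rw [hY, h, map_neg, map_one, neg_one_mul, C.involution_yCoord])]
      exact hι
  intro g h hgh
  have h1 : affinePoly α β (h⁻¹ * g) = X := by
    rw [hL.affine_mul, hgh, ← hL.affine_mul, inv_mul_cancel, hL.affine_one]
  exact (inv_mul_eq_one.mp (key _ h1)).symm

variable [Finite G]

include hX hY in
-- Replace the denominator by the product of its translates, which is invariant; then compare
-- coefficients of `1` and `Y` under each `g`.
theorem exists_of_mem_fixedField {z : C.FunctionField}
    (hz : z ∈ IntermediateField.fixedField G) : ∃ p q c : k[X], c ≠ 0 ∧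
      IsSemiInvariant α β (fun _ => 1) p ∧
      IsSemiInvariant α β (fun g => (γ g)⁻¹) q ∧
      IsSemiInvariant α β (fun _ => 1) c ∧
      z * aeval C.xCoord c = aeval C.xCoord p + aeval C.xCoord q * C.yCoord := by
  classical
  have := Fintype.ofFinite G
  have hL := isAffineAction hX
  obtain ⟨p₀, q₀, c₀, hc₀, h₀⟩ := C.exists_mul_aeval_eq C.FunctionField z
  change z * aeval C.xCoord c₀ = aeval C.xCoord p₀ + aeval C.xCoord q₀ * C.yCoord at h₀
  let c := ∏ g, c₀.comp (affinePoly α β g)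
  have hc : c ≠ 0 := Finset.prod_ne_zero_iff.mpr fun g _ h => by
    have := degree_comp_affinePoly (β := β) (hL.α_ne_zero g) c₀
    rw [h, degree_zero, eq_comm, degree_eq_bot] at this
    exact hc₀ this
  have hcinv : IsSemiInvariant α β (fun _ => 1) c := fun g => by
    rw [C_1, one_mul, Polynomial.prod_comp]
    simp_rw [comp_assoc, ← hL.affine_mul]
    exact Fintype.prod_equiv (Equiv.mulLeft g) _ _ fun _ => rfl
  obtain ⟨d, hd⟩ : c₀ ∣ c := by
    have := Finset.dvd_prod_of_mem (fun g => c₀.comp (affinePoly α β g)) (Finset.mem_univ (1 : G))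
    rwa [hL.affine_one, comp_X] at this
  obtain ⟨p, q, h⟩ : ∃ p q : k[X], z * aeval C.xCoord c =
      aeval C.xCoord p + aeval C.xCoord q * C.yCoord := by
    refine ⟨p₀ * d, q₀ * d, ?_⟩
    rw [hd, map_mul, map_mul, map_mul, ← mul_assoc, h₀]
    ring
  have hg : ∀ g : G, p.comp (affinePoly α β g) = p ∧
      Polynomial.C (γ g) * q.comp (affinePoly α β g) = q := by
    intro g
    have h1 := congrArg (g : C.FunctionField ≃ₐ[k] C.FunctionField) h
    rw [map_mul, map_add, map_mul, apply_aeval_xCoord hX, apply_aeval_xCoord hX,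
      apply_aeval_xCoord hX, hcinv g, C_1, one_mul, hY,
      (IntermediateField.mem_fixedField_iff G z).mp hz g g.2, h] at h1
    have h2 := C.aeval_add_mul_yIn_eq_zero C.FunctionField
      (p := p.comp (affinePoly α β g) - p)
      (q := Polynomial.C (γ g) * q.comp (affinePoly α β g) - q) (by
        change aeval C.xCoord _ + aeval C.xCoord _ * C.yCoord = 0
        rw [map_sub, map_sub, map_mul _ (Polynomial.C _), aeval_C]
        linear_combination -h1)
    exact ⟨sub_eq_zero.mp h2.1, sub_eq_zero.mp h2.2⟩
  refine ⟨p, q, c, hc, fun g => ?_, fun g => ?_, hcinv, h⟩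
  · rw [C_1, one_mul, (hg g).1]
  · conv_rhs => rw [← (hg g).2]
    rw [← mul_assoc, ← C_mul, inv_mul_cancel₀ (yCharacter_ne_zero hY g), C_1, one_mul]

omit [Finite G] in
include hX in
theorem aeval_mem_fixedField {p : k[X]} (hp : IsSemiInvariant α β (fun _ => 1) p) :
    aeval C.xCoord p ∈ IntermediateField.fixedField G := by
  rw [IntermediateField.mem_fixedField_iff]
  intro g hg
  rw [apply_aeval_xCoord hX ⟨g, hg⟩, hp, C_1, one_mul]

omit [Finite G] in
theorem coe_aeval_mk {t : k[X]} (h : aeval C.xCoord t ∈ IntermediateField.fixedField G)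
    (p : k[X]) : ((aeval (⟨_, h⟩ : C.QuotientFunctionField G) p : C.QuotientFunctionField G) :
      C.FunctionField) = aeval C.xCoord (p.comp t) := by
  rw [aeval_comp]
  exact (aeval_algHom_apply (IntermediateField.val _) _ p).symm

omit [Finite G] in
theorem transcendental_mk {t : k[X]} (h : aeval C.xCoord t ∈ IntermediateField.fixedField G)
    (ht : 0 < t.natDegree) : Transcendental k (⟨_, h⟩ : C.QuotientFunctionField G) := by
  rw [transcendental_iff]
  intro p hp
  have h1 := congrArg (Subtype.val) hp
  rw [coe_aeval_mk, ZeroMemClass.coe_zero, map_eq_zero_iff _ C.aeval_xCoord_injective,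
    comp_eq_zero_iff] at h1
  rcases h1 with h1 | ⟨-, h1⟩
  · exact h1
  · rw [h1, natDegree_C] at ht
    exact absurd ht (lt_irrefl 0)

include hX hY in
/-- If the involution belongs to the group, then the quotient curve is rational. -/
theorem curveGenus_of_involution_mem (h2 : (2 : k) ≠ 0) (hι : C.involution ∈ G) :
    Module.Finite k (regularDifferentials k (C.QuotientFunctionField G)) ∧
      curveGenus k (C.QuotientFunctionField G) = 0 := by
  have hL := isAffineAction hX
  obtain ⟨t, ht0, ht, -, hgen⟩ := hL.exists_generator_invariants
  have htmem := aeval_mem_fixedField hX ht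
  let T : C.QuotientFunctionField G := ⟨aeval C.xCoord t, htmem⟩
  have hιX : affinePoly α β ⟨_, hι⟩ = X := by
    apply C.aeval_xCoord_injective
    have := apply_aeval_xCoord hX ⟨_, hι⟩ X
    rw [X_comp] at this
    rw [← this, aeval_X]
    exact C.involution_xCoord
  have hιγ : γ ⟨_, hι⟩ = -1 := by
    have h := hY ⟨_, hι⟩
    have h' : C.involution C.yCoord = algebraMap k C.FunctionField (-1) * C.yCoord := by
      rw [C.involution_yCoord, map_neg, map_one, neg_one_mul]
    exact (algebraMap k C.FunctionField).injective
      (mul_right_cancel₀ yCoord_ne_zero (h.symm.trans h'))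
  -- The rational field `k(T)` is presented as the curve `z² = x` with `x = T²`, `z = T`, so that
  -- the genus formula covers it.
  have htop : IntermediateField.adjoin k {T ^ 2, T} = ⊤ := by
    set E := IntermediateField.adjoin k {T ^ 2, T}
    have hT : T ∈ E := IntermediateField.subset_adjoin _ _ (by simp)
    have haeval : ∀ p : k[X], aeval T p ∈ E := fun p => by
      rw [aeval_eq_sum_range]
      exact sum_mem fun i _ => E.smul_mem (pow_mem hT i)
    rw [eq_top_iff]
    rintro z -
    obtain ⟨p, q, c, hc, hp, hq, hc', h⟩ := exists_of_mem_fixedField hX hY z.2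
    -- Invariance under `ι` gives `q = -q`.
    have hq0 : q = 0 := by
      have := hq ⟨_, hι⟩
      simp only [hιX, hιγ, comp_X, inv_neg, inv_one, map_neg, C_1, neg_one_mul] at this
      have h3 : Polynomial.C (2 : k) * q = 0 := by
        rw [map_ofNat]
        linear_combination this
      exact (mul_eq_zero.mp h3).resolve_left (C_ne_zero.mpr h2)
    obtain ⟨p', rfl⟩ := hgen p hp
    obtain ⟨c', rfl⟩ := hgen c hc'
    have hz : z * aeval T c' = aeval T p' := by
      apply Subtype.ext
      rw [MulMemClass.coe_mul, coe_aeval_mk, coe_aeval_mk, h, hq0, map_zero, zero_mul, add_zero]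
    have hne : aeval T c' ≠ 0 := fun h0 => by
      obtain rfl := transcendental_iff.mp (transcendental_mk htmem ht0) c' h0
      exact hc zero_comp
    rw [← eq_div_iff hne] at hz
    rw [hz]
    exact div_mem (haeval p') (haeval c')
  have := curveGenus_of_sq_eq_aeval h2 ((transcendental_mk htmem ht0).pow two_pos) (P := X)
    separable_X (by rw [natDegree_X]; exact one_pos) (aeval_X _).symm htop
  rwa [natDegree_X] at this

include hX hY in
/-- The equation of the quotient curve if the involution does not belong to the group. -/
theorem exists_equation_of_involution_notMem (h2 : (2 : k) ≠ 0) (hι : C.involution ∉ G) :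
    ∃ d : ℕ, 0 < d ∧ Module.Finite k (regularDifferentials k (C.QuotientFunctionField G)) ∧
      curveGenus k (C.QuotientFunctionField G) = (d - 1) / 2 ∧
      Nat.card G * (regularOrbits α β C.roots).ncard ≤ C.roots.ncard ∧
      ((∀ g, γ g = 1) →
        (regularOrbits α β C.roots).ncard = d ∧ C.roots.ncard = d * Nat.card G) ∧
      ((¬ ∀ g, γ g = 1) → (regularOrbits α β C.roots).ncard + 1 = d ∧
        C.roots.ncard < d * Nat.card G) := by
  have hL := isAffineAction hX
  have hinj := affinePoly_injective hX hY hι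
  obtain ⟨t, ht0, ht, htmin, hgen⟩ := hL.exists_generator_invariants
  have htdeg : t.natDegree = Nat.card G := by
    have := Fintype.ofFinite G
    refine le_antisymm ?_ (IsAffineAction.card_le_natDegree hinj ht ht0)
    rw [Nat.card_eq_fintype_card, ← hL.natDegree_prod_affinePoly]
    refine htmin _ (fun g => by rw [hL.prod_affinePoly_comp, C_1, one_mul]) ?_
    rw [hL.natDegree_prod_affinePoly]
    exact Fintype.card_pos
  -- The inverse character is chosen so that a semi-invariant times `Y` is `G`-invariant.
  obtain ⟨s, hs0, hs⟩ := hL.exists_semiInvariant hinj (yCharacter hY)⁻¹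
  simp only [coe_inv_yCharacter] at hs
  obtain ⟨u, hu0, hu, humin, hugen⟩ := hL.exists_minimal_semiInvariant hs0 hs
  have hγ := yCharacter_ne_zero hY
  -- If `deg u ≥ deg t`, the remainder modulo `t` vanishes by minimality, and then `u / t` is a
  -- smaller semi-invariant of the same character.
  have hudeg : u.natDegree < Nat.card G := by
    by_contra! hle
    have htne : t ≠ 0 := by rintro rfl; simp at ht0
    have h1 := fun g => comp_mod_and_div_of_comp_eq (hL.α_ne_zero g) htne (ht g) (hu g)
    have h3 : u % t = 0 := by
      by_contra h
      have := humin _ (fun g => (h1 g).1) h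
      have := natDegree_mod_lt u ht0.ne'
      omega
    have h4 := EuclideanDomain.div_add_mod u t
    rw [h3, add_zero] at h4
    have h5 : u / t ≠ 0 := fun h => hu0 (by rw [← h4, h, mul_zero])
    have h6 := humin (u / t) (fun g => by simpa only [C_1, one_mul] using (h1 g).2) h5
    have h7 := congrArg natDegree h4
    rw [natDegree_mul htne h5] at h7
    omega
  have hf := isSemiInvariant_f hX hY
  obtain ⟨P, hP⟩ := hgen (u ^ 2 * C.f) (fun g => by
    rw [mul_comp, pow_comp, hu g, hf g, mul_pow, ← C_pow, mul_mul_mul_comm, ← C_mul, inv_pow,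
      inv_mul_cancel₀ (pow_ne_zero 2 (hγ g))])
  replace hP := hP.symm
  have hPsep := IsAffineAction.separable_of_comp_eq htdeg C.separable hu0 hudeg hP
  have hPdeg := IsAffineAction.natDegree_mul_card htdeg C.separable hu0 hP
  have hPpos : 0 < P.natDegree := by
    have := C.natDegree_pos
    by_contra! h
    rw [Nat.le_zero.mp h, zero_mul] at hPdeg
    omega
  have htmem := aeval_mem_fixedField hX ht
  let T : C.QuotientFunctionField G := ⟨aeval C.xCoord t, htmem⟩
  have hzmem : aeval C.xCoord u * C.yCoord ∈ IntermediateField.fixedField G := by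
    rw [IntermediateField.mem_fixedField_iff]
    intro g hg
    rw [map_mul, apply_aeval_xCoord hX ⟨g, hg⟩, hu, hY ⟨g, hg⟩, map_mul, aeval_C,
      mul_mul_mul_comm, ← map_mul, inv_mul_cancel₀ (hγ _), map_one, one_mul]
  let Z : C.QuotientFunctionField G := ⟨aeval C.xCoord u * C.yCoord, hzmem⟩
  have hZ : Z ^ 2 = aeval T P := by
    apply Subtype.ext
    rw [coe_aeval_mk, hP, map_mul, map_pow]
    change (aeval C.xCoord u * C.yCoord) ^ 2 = _
    rw [mul_pow]
    congr 1
    exact C.yIn_sq C.FunctionField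
  have htop : IntermediateField.adjoin k {T, Z} = ⊤ := by
    set E := IntermediateField.adjoin k {T, Z}
    have hT : T ∈ E := IntermediateField.subset_adjoin _ _ (by simp)
    have hZE : Z ∈ E := IntermediateField.subset_adjoin _ _ (by simp)
    have haeval : ∀ p : k[X], aeval T p ∈ E := fun p => by
      rw [aeval_eq_sum_range]
      exact sum_mem fun i _ => E.smul_mem (pow_mem hT i)
    rw [eq_top_iff]
    rintro z -
    obtain ⟨p, q, c, hc, hp, hq, hc', h⟩ := exists_of_mem_fixedField hX hY z.2
    obtain ⟨q, hq', rfl⟩ := hugen q hq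
    obtain ⟨p', rfl⟩ := hgen p hp
    obtain ⟨q', rfl⟩ := hgen q hq'
    obtain ⟨c', rfl⟩ := hgen c hc'
    have hz : z * aeval T c' = aeval T p' + aeval T q' * Z := by
      apply Subtype.ext
      rw [MulMemClass.coe_mul, AddMemClass.coe_add, MulMemClass.coe_mul, coe_aeval_mk,
        coe_aeval_mk, coe_aeval_mk, h, map_mul]
      ring
    have hne : aeval T c' ≠ 0 := fun h0 => by
      obtain rfl := transcendental_iff.mp (transcendental_mk htmem ht0) c' h0
      exact hc zero_comp
    rw [← eq_div_iff hne] at hz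
    rw [hz]
    exact div_mem (add_mem (haeval p') (mul_mem (haeval q') hZE)) (haeval c')
  obtain ⟨hfin, hgenus⟩ :=
    curveGenus_of_sq_eq_aeval h2 (transcendental_mk htmem ht0) hPsep hPpos hZ htop
  have hR : C.roots.ncard = C.f.natDegree := ncard_rootSet_of_separable C.separable
  refine ⟨P.natDegree, hPpos, hfin, hgenus, ?_, fun hγ1 => ?_, fun hγ1 => ?_⟩
  · rw [hR]
    exact hL.card_mul_ncard_regularOrbits_le hinj ht htdeg C.separable hf
  · have hu1 : u.natDegree = 0 := by
      have := humin 1 (fun g => by simp [hγ1]) one_ne_zero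
      rwa [natDegree_one, Nat.le_zero] at this
    refine ⟨hL.ncard_regularOrbits_of_natDegree_eq_zero hinj ht htdeg C.separable hu0 hu hudeg hP
      hu1, ?_⟩
    rw [hR, hPdeg, hu1, mul_zero, zero_add]
  -- A nonzero constant is fixed by every substitution, so its character `γ⁻¹` would be trivial.
  · have hu1 : u.natDegree ≠ 0 := by
      intro h
      obtain ⟨e, rfl⟩ := natDegree_eq_zero.mp h
      refine hγ1 fun g => ?_
      have h1 := hu g
      rw [C_comp, ← C_mul] at h1
      have h3 := (mul_eq_right₀ (C_ne_zero.mp hu0)).mp (C_injective h1).symm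
      exact inv_eq_one.mp h3
    refine ⟨hL.ncard_regularOrbits_add_one hinj ht htdeg C.separable hu0 hu hudeg hP hu1, ?_⟩
    rw [hR, hPdeg]
    omega

end AffineGroup

end HyperellipticCurve

end

theorem corollary2p5 {k : Type*} [Field k] (hk : ringChar k ≠ 2) (C : HyperellipticCurve k)
    (G : Subgroup (C.FunctionField ≃ₐ[k] C.FunctionField)) [Finite G]
    (α β γ : G → k)
    (hX : ∀ g : G, (g : C.FunctionField ≃ₐ[k] C.FunctionField) C.xCoord =
      algebraMap k C.FunctionField (α g) * C.xCoord + algebraMap k C.FunctionField (β g))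
    (hY : ∀ g : G, (g : C.FunctionField ≃ₐ[k] C.FunctionField) C.yCoord =
      algebraMap k C.FunctionField (γ g) * C.yCoord) :
    Module.Finite k (regularDifferentials k (C.QuotientFunctionField G)) ∧
    (C.involution ∈ G → curveGenus k (C.QuotientFunctionField G) = 0) ∧
    ((∀ g, γ g = 1) →
      (curveGenus k (C.QuotientFunctionField G) : ℤ) =
          ⌊((regularOrbits α β C.roots).ncard : ℚ) / 2 - 1 / 2⌋ ∧
      (curveGenus k (C.QuotientFunctionField G) : ℤ) =
          ⌊(C.roots.ncard : ℚ) / (2 * (Nat.card G : ℚ)) - 1 / 2⌋) ∧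
    (C.involution ∉ G → (¬ ∀ g, γ g = 1) →
      (curveGenus k (C.QuotientFunctionField G) : ℤ) =
          ⌊((regularOrbits α β C.roots).ncard : ℚ) / 2⌋ ∧
      (curveGenus k (C.QuotientFunctionField G) : ℤ) =
          ⌊(C.roots.ncard : ℚ) / (2 * (Nat.card G : ℚ))⌋) := by
  have h2 : (2 : k) ≠ 0 := Ring.two_ne_zero hk
  by_cases hι : C.involution ∈ G
  · obtain ⟨hfin, h0⟩ := HyperellipticCurve.curveGenus_of_involution_mem hX hY h2 hι
    refine ⟨hfin, fun _ => h0, fun hγ => ?_, fun h => absurd hι h⟩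
    -- Here `γ` trivial is incompatible with `ι ∈ G`: it would give `-Y = Y`.
    have h := hY ⟨_, hι⟩
    rw [hγ, map_one, one_mul] at h
    have h' : -C.yCoord = C.yCoord := C.involution_yCoord.symm.trans h
    have h2F : (2 : C.FunctionField) ≠ 0 := by
      rw [← map_ofNat (algebraMap k C.FunctionField) 2]
      exact (_root_.map_ne_zero _).mpr h2
    refine absurd ?_ (mul_ne_zero h2F (HyperellipticCurve.yCoord_ne_zero (C := C)))
    linear_combination -h'
  obtain ⟨d, hd, hfin, hgenus, hle, htriv, hnontriv⟩ :=
    HyperellipticCurve.exists_equation_of_involution_notMem hX hY h2 hι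
  have hN : (0 : ℚ) < Nat.card G := Nat.cast_pos.mpr Nat.card_pos
  refine ⟨hfin, fun h => absurd h hι, fun hγ => ?_, fun _ hγ => ?_⟩
  · obtain ⟨hr, hR⟩ := htriv hγ
    have hfloor : (curveGenus k (C.QuotientFunctionField G) : ℤ) = ⌊(d : ℚ) / 2 - 1 / 2⌋ := by
      rw [eq_comm, Int.floor_eq_iff, hgenus]
      obtain ⟨m, hm | hm⟩ : ∃ m, d - 1 = 2 * m ∨ d - 1 = 2 * m + 1 :=
        ⟨(d - 1) / 2, by omega⟩
      · obtain rfl : d = 2 * m + 1 := by omega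
        rw [hm, Nat.mul_div_cancel_left _ two_pos]
        push_cast
        constructor <;> linarith
      · obtain rfl : d = 2 * m + 1 + 1 := by omega
        rw [hm, show (2 * m + 1) / 2 = m by omega]
        push_cast
        constructor <;> linarith
    refine ⟨by rw [hr, hfloor], ?_⟩
    rw [hR, hfloor]
    congr 2
    push_cast
    field_simp
  · obtain ⟨hr, hR⟩ := hnontriv hγ
    set r := (regularOrbits α β C.roots).ncard
    set g := curveGenus k (C.QuotientFunctionField G)
    -- Since `deg P = r + 1`, the genus is `⌊r/2⌋`; the bounds `r |G| ≤ |R| < (r + 1)|G|` below give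
    -- `|R|/(2|G|)` the same floor.
    have hg1 : 2 * g ≤ r := by omega
    have hg2 : r ≤ 2 * g + 1 := by omega
    have hq1 : (2 * g : ℚ) ≤ r := by exact_mod_cast hg1
    have hq2 : (r : ℚ) ≤ 2 * g + 1 := by exact_mod_cast hg2
    have hR1 : (Nat.card G : ℚ) * r ≤ C.roots.ncard := by exact_mod_cast hle
    have hR2 : (C.roots.ncard : ℚ) < (r + 1) * Nat.card G := by
      rw [← hr] at hR
      exact_mod_cast hR
    constructor
    · rw [eq_comm, Int.floor_eq_iff]
      push_cast
      constructor <;> linarith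
    · rw [eq_comm, Int.floor_eq_iff, le_div_iff₀ (by positivity), div_lt_iff₀ (by positivity)]
      push_cast
      constructor <;> nlinarith
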